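/- Notation. Let $d\ge 1$. For $u\in\mathscr S'(\mathbf R^d)$ and $\varphi\in\mathscr S(\mathbf R^d)$ let $(u,\varphi)$ be the action that is linear in $u$, conjugate linear in $\varphi$, and extends the $L^2$ inner product. Put $V_\varphi u(x,\xi)=(2\pi)^{-d/2}\,\bigl(u,\ e^{i\langle\cdot,\xi\rangle}\varphi(\cdot-x)\bigr)$ for $x,\xi\in\mathbf R^d$. Let $D^\alpha=(-i)^{|\alpha|}\partial^\alpha$ and $\langle (x,\xi)\rangle=(1+|x|^2+|\xi|^2)^{1/2}$. For $s,t>0$ let $\Sigma_t^s(\mathbf R^d)$ be the space of $f\in C^\infty(\mathbf R^d)$ (necessarily Schwartz functions) with $$\sup_{x,\alpha,\beta}\frac{|x^\alpha D^\beta f(x)|}{h^{|\alpha+\beta|}\,\alpha!^t\,\beta!^s}<\infty\qquad\text{for all } h>0 .$$ Fix a window $\varphi\in\mathscr S(\mathbf R^d)\setminus 0$. For $u\in\mathscr S'(\mathbf R^d)$, the Gabor wave front set $\mathrm{WF_g}(u)$ is the set of $z_0\in\mathbf R^{2d}\setminus 0$ for which there is no open conic set $\Gamma\subseteq\mathbf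 R^{2d}\setminus 0$ with $z_0\in\Gamma$ and $\sup_{z\in\Gamma}\langle z\rangle^N|V_\varphi u(z)|<\infty$ for all $N\ge 0$. Fix $s,t>0$ with $s+t>1$ and a window $\psi\in\Sigma_t^s(\mathbf R^d)\setminus 0$. For $u\in\mathscr S'(\mathbf R^d)$, the $t,s$-Gelfand--Shilov wave front set $\mathrm{WF}^{t,s}(u)$ is the set of $z_0\in\mathbf R^{2d}\setminus 0$ for which there is no open set $U\subseteq\mathbf R^{2d}\setminus 0$ with $z_0\in U$ and $$\sup_{\lambda>0,\ (x,\xi)\in U}e^{r\lambda}\,|V_\psi u(\lambda^t x,\lambda^s\xi)|<\infty\qquad\text{for all } r>0 .$$ Proposition. Let $s,t>0$ with $s+t>1$, let $m\ge 1$, and let $$p(x)=\sum_{|\alpha|\le m}c_\alpha x^\alpha,\qquad x\in\mathbf R^d,\ c_\alpha\in\mathbf C,$$ be a polynomial that is not identically zero. Put $$u=\sum_{|\alpha|\le m}c_\alpha D^\alpha\delta_0\in\mathscr S'(\mathbf R^d).$$ Then, for every choice of windows $\varphi\in\mathscr S(\mathbf R^d)\setminus 0$ and $\psi\in\Sigma_t^s(\mathbf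 R^d)\setminus 0$, $$\mathrm{WF_g}(u)=\mathrm{WF}^{t,s}(u)=\{0\}\times(\mathbf R^d\setminus 0)$$ and $$\mathrm{WF_g}(p)=\mathrm{WF}^{t,s}(p)=(\mathbf R^d\setminus 0)\times\{0\}.$$ -/

import Mathlib

open scoped SchwartzMap LineDeriv

namespace AnisotropicWF

/-- The space `ℝ^d` with its Euclidean structure. -/
abbrev Rd (d : ℕ) := EuclideanSpace ℝ (Fin d)

/-- The oscillation `y ↦ exp (i ⟨y, ξ⟩)`. -/
noncomputable def planeWave {d : ℕ} (ξ : Rd d) (y : Rd d) : ℂ :=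
  Complex.exp (Complex.I * ((inner ℝ y ξ : ℝ) : ℂ))

theorem planeWave_hasTemperateGrowth {d : ℕ} (ξ : Rd d) :
    (planeWave ξ).HasTemperateGrowth := by
  have hderiv : ∀ n : ℕ, iteratedDeriv n (fun r : ℝ => Complex.exp (Complex.I * (r : ℂ))) =
      fun r : ℝ => Complex.I ^ n * Complex.exp (Complex.I * (r : ℂ)) := by
    intro n
    induction n with
    | zero => simp
    | succ n ih =>
      rw [iteratedDeriv_succ, ih]
      ext r
      have h1 : HasDerivAt (fun r : ℝ => Complex.I * (r : ℂ)) (Complex.I * 1) r :=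
        (Complex.ofRealCLM.hasDerivAt (x := r)).const_mul Complex.I
      rw [(h1.cexp.const_mul (Complex.I ^ n)).deriv]
      ring
  have hexp : (fun r : ℝ => Complex.exp (Complex.I * (r : ℂ))).HasTemperateGrowth := by
    refine ⟨(contDiff_const.mul Complex.ofRealCLM.contDiff).cexp, fun n => ⟨0, 1, fun r => ?_⟩⟩
    rw [norm_iteratedFDeriv_eq_norm_iteratedDeriv, hderiv n]
    simp [mul_comm Complex.I, Complex.norm_exp_ofReal_mul_I]
  exact hexp.comp (Function.hasTemperateGrowth_inner_left ξ)

/-- The translation `T_x φ (y) = φ (y - x)`. -/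
noncomputable def translation {d : ℕ} (x : Rd d) (φ : 𝓢(Rd d, ℂ)) : 𝓢(Rd d, ℂ) :=
  SchwartzMap.compSubConstCLM ℂ x φ

/-- The modulation `M_ξ φ (y) = exp (i ⟨y, ξ⟩) φ (y)`. -/
noncomputable def modulation {d : ℕ} (ξ : Rd d) (φ : 𝓢(Rd d, ℂ)) : 𝓢(Rd d, ℂ) :=
  SchwartzMap.smulLeftCLM ℂ (planeWave ξ) φ

/-- Pointwise complex conjugation of a Schwartz function. -/
noncomputable def conjugate {d : ℕ} (φ : 𝓢(Rd d, ℂ)) : 𝓢(Rd d, ℂ) :=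
  SchwartzMap.postcompCLM (𝕜 := ℝ) (Complex.conjCLE : ℂ →L[ℝ] ℂ) φ

@[simp]
theorem translation_apply {d : ℕ} (x : Rd d) (φ : 𝓢(Rd d, ℂ)) (y : Rd d) :
    translation x φ y = φ (y - x) := rfl

@[simp]
theorem modulation_apply {d : ℕ} (ξ : Rd d) (φ : 𝓢(Rd d, ℂ)) (y : Rd d) :
    modulation ξ φ y = planeWave ξ y * φ y := by
  simp [modulation, SchwartzMap.smulLeftCLM_apply_apply (planeWave_hasTemperateGrowth ξ)]

@[simp]
theorem conjugate_apply {d : ℕ} (φ : 𝓢(Rd d, ℂ)) (y : Rd d) :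
    conjugate φ y = starRingEnd ℂ (φ y) := by
  simp [conjugate]

/-- The action `(u, φ)` of a tempered distribution, linear in `u` and conjugate linear in `φ`,
consistent with the `L²` inner product `∫ u(y) conj(φ(y)) dy`. -/
noncomputable def sesqAction {d : ℕ} (u : 𝓢'(Rd d, ℂ)) (φ : 𝓢(Rd d, ℂ)) : ℂ :=
  u (conjugate φ)

/-- The short-time Fourier transform `V_φ u (x, ξ) = (2π)^(-d/2) (u, M_ξ T_x φ)`. -/
noncomputable def stft {d : ℕ} (φ : 𝓢(Rd d, ℂ)) (u : 𝓢'(Rd d, ℂ)) (x ξ : Rd d) : ℂ :=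
  (((2 * Real.pi) ^ (-(d : ℝ) / 2) : ℝ) : ℂ) * sesqAction u (modulation ξ (translation x φ))

/-- The length `|α|` of a multi-index. -/
def multiLength {d : ℕ} (α : Fin d →₀ ℕ) : ℕ := ∑ i, α i

/-- The factorial `α!` of a multi-index. -/
def multiFactorial {d : ℕ} (α : Fin d →₀ ℕ) : ℕ := ∏ i, (α i).factorial

/-- The monomial `x^α`. -/
noncomputable def monomialFn {d : ℕ} (α : Fin d →₀ ℕ) (x : Rd d) : ℝ := ∏ i, x i ^ α i

/-- The operator `D^α = (-i)^|α| ∂_1^(α_1) ⋯ ∂_d^(α_d)`, on Schwartz functions and on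
tempered distributions alike. -/
noncomputable def multiD {d : ℕ} {V : Type*} [SMul ℂ V] [LineDeriv (Rd d) V V]
    (α : Fin d →₀ ℕ) (f : V) : V :=
  (-Complex.I) ^ multiLength α •
    (List.finRange d).foldr
      (fun i g => (fun w : V => ∂_{(EuclideanSpace.single i (1 : ℝ) : Rd d)} w)^[α i] g) f

/-- Membership in the Beurling type Gelfand--Shilov space `Σ_t^s(ℝ^d)`: for every `h > 0`,
`sup |x^α D^β f(x)| / (h^|α+β| α!^t β!^s) < ∞`, the supremum over all `x`, `α`, `β`.
(Smooth functions with this property are Schwartz functions.) -/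
def IsGelfandShilov {d : ℕ} (t s : ℝ) (f : 𝓢(Rd d, ℂ)) : Prop :=
  ∀ h : ℝ, 0 < h → ∃ C : ℝ, ∀ (α β : Fin d →₀ ℕ) (x : Rd d),
    ‖(monomialFn α x : ℂ) * multiD β f x‖ /
      (h ^ multiLength (α + β) * (multiFactorial α : ℝ) ^ t * (multiFactorial β : ℝ) ^ s) ≤ C

/-- The phase space `T*ℝ^d`, with points `(x, ξ)`. -/
abbrev PhaseSpace (d : ℕ) := Rd d × Rd d

/-- The bracket `⟨z⟩ = (1 + |x|² + |ξ|²)^(1/2)` of `z = (x, ξ)`. -/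
noncomputable def bracket {d : ℕ} (z : PhaseSpace d) : ℝ :=
  Real.sqrt (1 + ‖z.1‖ ^ 2 + ‖z.2‖ ^ 2)

/-- The Gabor wave front set, computed with the window `φ`: the points `z₀ ≠ 0` of phase space
without an open conic neighbourhood `Γ` in `T*ℝ^d ∖ 0` in which `V_φ u` decays rapidly. -/
def gaborWF {d : ℕ} (φ : 𝓢(Rd d, ℂ)) (u : 𝓢'(Rd d, ℂ)) : Set (PhaseSpace d) :=
  {z₀ | z₀ ≠ 0 ∧ ¬ ∃ Γ : Set (PhaseSpace d), IsOpen Γ ∧ (0 : PhaseSpace d) ∉ Γ ∧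
    (∀ z ∈ Γ, ∀ a : ℝ, 0 < a → a • z ∈ Γ) ∧ z₀ ∈ Γ ∧
    ∀ N : ℕ, ∃ C : ℝ, ∀ z ∈ Γ, bracket z ^ N * ‖stft φ u z.1 z.2‖ ≤ C}

/-- The `t,s`-Gelfand--Shilov wave front set of a tempered distribution, computed with the window
`ψ`: the points `z₀ ≠ 0` of phase space without an open neighbourhood `U` in `T*ℝ^d ∖ 0` such that
`sup exp(r λ) |V_ψ u (λ^t x, λ^s ξ)| < ∞` for all `r > 0`, the supremum over `λ > 0` and
`(x, ξ) ∈ U`. -/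
def gelfandShilovWF {d : ℕ} (t s : ℝ) (ψ : 𝓢(Rd d, ℂ)) (u : 𝓢'(Rd d, ℂ)) :
    Set (PhaseSpace d) :=
  {z₀ | z₀ ≠ 0 ∧ ¬ ∃ U : Set (PhaseSpace d), IsOpen U ∧ (0 : PhaseSpace d) ∉ U ∧ z₀ ∈ U ∧
    ∀ r : ℝ, 0 < r → ∃ C : ℝ, ∀ a : ℝ, 0 < a → ∀ z ∈ U,
      Real.exp (r * a) * ‖stft ψ u (a ^ t • z.1) (a ^ s • z.2)‖ ≤ C}

/-- The polynomial function `x ↦ p(x)` on `ℝ^d`. -/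
noncomputable def polyFn {d : ℕ} (p : MvPolynomial (Fin d) ℂ) (x : Rd d) : ℂ :=
  MvPolynomial.eval (fun i => (x i : ℂ)) p

theorem polyFn_hasTemperateGrowth {d : ℕ} (p : MvPolynomial (Fin d) ℂ) :
    (polyFn p).HasTemperateGrowth := by
  induction p using MvPolynomial.induction_on with
  | C a =>
    have : polyFn (d := d) (MvPolynomial.C a) = fun _ => a := by ext x; simp [polyFn]
    rw [this]; exact Function.HasTemperateGrowth.const a
  | add p q hp hq =>
    have : polyFn (p + q) = polyFn p + polyFn q := by ext x; simp [polyFn]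
    rw [this]; exact hp.add hq
  | mul_X p i hp =>
    have : polyFn (p * MvPolynomial.X i) =
        polyFn p * (fun x : Rd d => ((EuclideanSpace.proj (𝕜 := ℝ) i x : ℝ) : ℂ)) := by
      ext x; simp [polyFn]
    rw [this]
    exact hp.mul (ContinuousLinearMap.hasTemperateGrowth
      (Complex.ofRealCLM ∘L (EuclideanSpace.proj (𝕜 := ℝ) i : Rd d →L[ℝ] ℝ)))

/-- The polynomial `p` as a tempered distribution, `φ ↦ ∫ p(x) φ(x) dx`. -/
noncomputable def polyDistribution {d : ℕ} (p : MvPolynomial (Fin d) ℂ) : 𝓢'(Rd d, ℂ) :=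
  Function.HasTemperateGrowth.toTemperedDistribution MeasureTheory.volume
    (polyFn_hasTemperateGrowth p)

/-- The distribution `p(D) δ_0 = ∑ c_α D^α δ_0` for `p(x) = ∑ c_α x^α`. -/
noncomputable def diracCombination {d : ℕ} (p : MvPolynomial (Fin d) ℂ) : 𝓢'(Rd d, ℂ) :=
  ∑ α ∈ p.support, p.coeff α • multiD α (TemperedDistribution.delta (0 : Rd d))

end AnisotropicWF

/-!
Let `g` be the conjugate of the window `φ`. By covariance of the short-time Fourier transform,
`|V_φ (p(D) δ_0) (x, ξ)|` is a constant times `|(p(D + ξ) δ_0) (g(· - x))|`, and `|V_φ p (x, ξ)|`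
is the same constant times `|∫ p(y + x) e^{-i⟨y, ξ⟩} g(y) dy|`. Expand
`p(X + ξ) = ∑_γ ξ^γ c_γ(X)`. Up to exchanging `x` and `ξ`, both expressions are
`|∑_γ ξ^γ Φ(c_γ)(x)|` for a linear map `Φ` from polynomials to functions. Every `Φ(q)` decays:
rapidly in general, and like `exp (-r |x_j|^{1/t})` for all `r > 0` (`1/s` in the second case) if
the window lies in `Σ_t^s`, because `Σ_t^s` is stable under `D_i` and under multiplication by
`y_i`. So there is no singularity off the axis `x = 0`.

For `γ` of top degree `c_γ` is a nonzero constant, and `Φ(1)(x)` is `g(-x)`, respectively the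
Fourier transform of `g` at `x`, which is nonzero at some `x₀`. Hence `|V(x₀, ξ)| = |q(ξ)|` for a
nonzero polynomial `q`. Any neighbourhood of a point `(0, ξ)` contains some `(0, η)` with
`q(η) ≠ 0`, and its dilates contain `(x₀, a η)` (or `(x₀, a^s η)`) for all large `a`. Since `q`
does not tend to zero along the ray through `η`, no decay is possible there.
-/

open scoped SchwartzMap LineDeriv FourierTransform
open Filter Topology MeasureTheory

namespace AnisotropicWF

section MultiIndex

variable {σ : Type*}

@[elab_as_elim]
theorem multiIndex_induction {motive : (σ →₀ ℕ) → Prop} (zero : motive 0)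
    (add_single : ∀ α i, motive α → motive (α + Finsupp.single i 1)) (α : σ →₀ ℕ) : motive α := by
  induction α using Finsupp.induction with
  | zero => exact zero
  | single_add i k α _ _ ih =>
    rw [add_comm]
    clear * - add_single ih
    induction k with
    | zero => simpa using ih
    | succ k ihk =>
      rw [Finsupp.single_add, ← add_assoc]
      exact add_single _ i ihk

end MultiIndex

section Taylor

variable {σ R : Type*} [CommSemiring R]

/-- The Taylor expansion `p(X + Y)` of a polynomial, as a polynomial in the increment `Y` whose
coefficients are polynomials in the base point `X`. -/
noncomputable def taylor : MvPolynomial σ R →ₐ[R] MvPolynomial σ (MvPolynomial σ R) :=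
  MvPolynomial.aeval fun i => MvPolynomial.X i + MvPolynomial.C (MvPolynomial.X i)

theorem coeff_taylor_monomial [DecidableEq σ] {α γ : σ →₀ ℕ} (h : α.degree ≤ γ.degree) :
    (taylor (MvPolynomial.monomial α (1 : R))).coeff γ = if γ = α then 1 else 0 := by
  induction α using multiIndex_induction generalizing γ with
  | zero => simp [MvPolynomial.coeff_one, eq_comm]
  | add_single α i ih =>
    rw [map_add, Finsupp.degree_single, Nat.succ_le_iff] at h
    have hγα : γ ≠ α := by rintro rfl; exact h.false
    rw [MvPolynomial.monomial_add_single, pow_one, map_mul, taylor, MvPolynomial.aeval_X, ← taylor,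
      mul_add, MvPolynomial.coeff_add, MvPolynomial.coeff_mul_X', mul_comm _ (MvPolynomial.C _),
      MvPolynomial.coeff_C_mul, ih h.le, if_neg hγα, mul_zero, add_zero]
    split_ifs with hi hγ hγ
    · rw [hγ, add_tsub_cancel_right, ih le_rfl, if_pos rfl]
    · have hle : Finsupp.single i 1 ≤ γ := by
        rwa [Finsupp.single_le_iff, Nat.one_le_iff_ne_zero, ← Finsupp.mem_support_iff]
      obtain ⟨β, rfl⟩ := exists_add_of_le hle
      rw [map_add, Finsupp.degree_single, add_comm, Nat.lt_succ_iff] at h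
      rw [add_tsub_cancel_left, ih h, if_neg]
      rintro rfl
      exact hγ (add_comm _ _)
    · exact absurd (by simp [hγ]) hi
    · rfl

theorem coeff_taylor_of_totalDegree_le {p : MvPolynomial σ R} {γ : σ →₀ ℕ}
    (h : p.totalDegree ≤ γ.degree) : (taylor p).coeff γ = MvPolynomial.C (p.coeff γ) := by
  classical
  conv_lhs => rw [p.as_sum]
  rw [map_sum, MvPolynomial.coeff_sum]
  have hterm : ∀ α ∈ p.support, (taylor (MvPolynomial.monomial α (p.coeff α))).coeff γ =
      if γ = α then MvPolynomial.C (p.coeff γ) else 0 := by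
    intro α hα
    rw [← mul_one (p.coeff α), ← smul_eq_mul, ← MvPolynomial.smul_monomial, map_smul,
      MvPolynomial.coeff_smul, coeff_taylor_monomial ((MvPolynomial.le_totalDegree hα).trans h)]
    split_ifs with hγ
    · rw [hγ, MvPolynomial.smul_eq_C_mul, mul_one]
    · rw [smul_zero]
  rw [Finset.sum_congr rfl hterm, Finset.sum_ite_eq]
  split_ifs with hγ
  · rfl
  · rw [MvPolynomial.notMem_support_iff.1 hγ, MvPolynomial.C_0]

theorem exists_coeff_taylor_eq_C {p : MvPolynomial σ R} (hp : p ≠ 0) :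
    ∃ γ, p.coeff γ ≠ 0 ∧ (taylor p).coeff γ = MvPolynomial.C (p.coeff γ) := by
  obtain ⟨γ, hγ, hdeg⟩ := Finset.exists_mem_eq_sup p.support (MvPolynomial.support_nonempty.2 hp)
    fun α => α.sum fun _ e => e
  exact ⟨γ, MvPolynomial.mem_support_iff.1 hγ, coeff_taylor_of_totalDegree_le hdeg.le⟩

end Taylor

section Translate

variable {d : ℕ}

/-- The translated polynomial `p(X + ξ)`. -/
noncomputable def translatePoly (ξ : Rd d) :
    MvPolynomial (Fin d) ℂ →ₐ[ℂ] MvPolynomial (Fin d) ℂ :=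
  MvPolynomial.aeval fun i => MvPolynomial.X i + MvPolynomial.C (ξ i : ℂ)

@[simp]
theorem translatePoly_X (ξ : Rd d) (i : Fin d) :
    translatePoly ξ (MvPolynomial.X i) = MvPolynomial.X i + MvPolynomial.C (ξ i : ℂ) :=
  MvPolynomial.aeval_X _ _

theorem translatePoly_eq_sum (ξ : Rd d) (p : MvPolynomial (Fin d) ℂ) :
    translatePoly ξ p =
      ∑ γ ∈ (taylor p).support, (monomialFn γ ξ : ℂ) • (taylor p).coeff γ := by
  have heval : translatePoly ξ p =
      MvPolynomial.eval (fun i => MvPolynomial.C (ξ i : ℂ)) (taylor p) := by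
    rw [translatePoly, taylor]
    induction p using MvPolynomial.induction_on with
    | C a => simp [MvPolynomial.algebraMap_eq, MvPolynomial.algebraMap_apply]
    | add p q hp hq => rw [map_add, map_add, map_add, hp, hq]
    | mul_X p i hp =>
      rw [map_mul, map_mul, map_mul, hp, MvPolynomial.aeval_X, MvPolynomial.aeval_X, map_add,
        MvPolynomial.eval_X, MvPolynomial.eval_C, add_comm]
  rw [heval, MvPolynomial.eval_eq']
  refine Finset.sum_congr rfl fun γ _ => ?_
  simp [monomialFn, MvPolynomial.smul_eq_C_mul, mul_comm]

theorem exists_polyFn_eq_apply_translatePoly (L : MvPolynomial (Fin d) ℂ →ₗ[ℂ] ℂ) (hL : L 1 ≠ 0)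
    {p : MvPolynomial (Fin d) ℂ} (hp : p ≠ 0) :
    ∃ q : MvPolynomial (Fin d) ℂ, q ≠ 0 ∧ ∀ ξ, L (translatePoly ξ p) = polyFn q ξ := by
  refine ⟨∑ γ ∈ (taylor p).support, MvPolynomial.monomial γ (L ((taylor p).coeff γ)),
    fun h0 => ?_, fun ξ => ?_⟩
  · obtain ⟨γ, hγ, hcoeff⟩ := exists_coeff_taylor_eq_C hp
    have hLγ : L ((taylor p).coeff γ) ≠ 0 := by
      rw [hcoeff, ← mul_one (MvPolynomial.C _), ← MvPolynomial.smul_eq_C_mul, map_smul]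
      exact smul_ne_zero hγ hL
    have hmem : γ ∈ (taylor p).support :=
      MvPolynomial.mem_support_iff.2 fun h => hLγ (by rw [h, map_zero])
    have := congrArg (MvPolynomial.coeff γ) h0
    classical
    simp only [MvPolynomial.coeff_sum, MvPolynomial.coeff_monomial, Finset.sum_ite_eq', if_pos hmem,
      MvPolynomial.coeff_zero] at this
    exact hLγ this
  · simp only [translatePoly_eq_sum, map_sum, map_smul, polyFn, MvPolynomial.eval_monomial]
    refine Finset.sum_congr rfl fun γ _ => ?_
    rw [Finsupp.prod_fintype _ _ fun i => pow_zero _]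
    simp [monomialFn, mul_comm]

theorem abs_monomialFn_le (α : Fin d →₀ ℕ) (ξ : Rd d) :
    |monomialFn α ξ| ≤ (1 + ‖ξ‖) ^ α.degree := by
  rw [monomialFn, Finset.abs_prod, Finsupp.degree_eq_sum, ← Finset.prod_pow_eq_pow_sum]
  refine Finset.prod_le_prod (fun i _ => abs_nonneg _) fun i _ => ?_
  rw [abs_pow]
  gcongr
  have := PiLp.norm_apply_le ξ i
  rw [Real.norm_eq_abs] at this
  linarith

theorem exists_weight_mul_norm_translatePoly_le {X : Type*}
    (Φ : MvPolynomial (Fin d) ℂ →ₗ[ℂ] (X → ℂ)) {w : X → ℝ} (hw : ∀ x, 0 ≤ w x)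
    (hΦ : ∀ q, ∃ C : ℝ, ∀ x, w x * ‖Φ q x‖ ≤ C) (p : MvPolynomial (Fin d) ℂ) :
    ∃ C : ℝ, ∀ x ξ,
      w x * ‖Φ (translatePoly ξ p) x‖ ≤ C * (1 + ‖ξ‖) ^ (taylor p).totalDegree := by
  choose C hC using hΦ
  refine ⟨∑ γ ∈ (taylor p).support, C ((taylor p).coeff γ), fun x ξ => ?_⟩
  rw [translatePoly_eq_sum, map_sum, Finset.sum_apply, Finset.sum_mul]
  refine (mul_le_mul_of_nonneg_left (norm_sum_le _ _) (hw x)).trans ?_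
  rw [Finset.mul_sum]
  refine Finset.sum_le_sum fun γ hγ => ?_
  have hmono : |monomialFn γ ξ| ≤ (1 + ‖ξ‖) ^ (taylor p).totalDegree :=
    (abs_monomialFn_le γ ξ).trans
      (pow_le_pow_right₀ (by linarith [norm_nonneg ξ]) (MvPolynomial.le_totalDegree hγ))
  rw [map_smul, Pi.smul_apply, norm_smul, Complex.norm_real, Real.norm_eq_abs, mul_left_comm,
    mul_comm]
  exact mul_le_mul (hC _ x) hmono (abs_nonneg _)
    ((mul_nonneg (hw x) (norm_nonneg _)).trans (hC _ x))

end Translate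

section Nonvanishing

variable {d : ℕ} {p : MvPolynomial (Fin d) ℂ}

theorem dense_polyFn_ne_zero (hp : p ≠ 0) : Dense {x : Rd d | polyFn p x ≠ 0} := by
  rw [← Set.compl_ofPred, ← interior_eq_empty_iff_dense_compl, Set.eq_empty_iff_forall_notMem]
  intro x hx
  have hopen : IsOpen ((WithLp.toLp 2 : (Fin d → ℝ) → Rd d) ⁻¹' interior {y | polyFn p y = 0}) :=
    isOpen_interior.preimage (PiLp.continuous_toLp 2 _)
  obtain ⟨u, hu, hsub⟩ := isOpen_pi_iff'.1 hopen (WithLp.ofLp x) hx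
  refine hp (MvPolynomial.funext_set (fun i => Complex.ofReal '' u i) (fun i => ?_) fun z hz => ?_)
  · exact (infinite_of_mem_nhds _ ((hu i).1.mem_nhds (hu i).2)).image
      Complex.ofReal_injective.injOn
  · choose w hw hwz using fun i => hz i (Set.mem_univ i)
    obtain rfl : (fun i => (w i : ℂ)) = z := funext hwz
    have hmem : WithLp.toLp 2 w ∈ interior {y : Rd d | polyFn p y = 0} := hsub fun i _ => hw i
    have hzero : WithLp.toLp 2 w ∈ {y : Rd d | polyFn p y = 0} := interior_subset hmem
    rw [map_zero]
    exact hzero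

theorem exists_mem_polyFn_ne_zero (hp : p ≠ 0) {U : Set (PhaseSpace d)} (hU : IsOpen U)
    {x ξ : Rd d} (h : (x, ξ) ∈ U) : ∃ η, (x, η) ∈ U ∧ polyFn p η ≠ 0 :=
  (dense_polyFn_ne_zero hp).inter_open_nonempty _ (hU.preimage (Continuous.prodMk_right x)) ⟨ξ, h⟩

theorem not_tendsto_polyFn_smul {ξ : Rd d} (h : polyFn p ξ ≠ 0) :
    ¬ Tendsto (fun a : ℝ => polyFn p (a • ξ)) atTop (𝓝 0) := by
  intro hlim
  set R : Polynomial ℂ :=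
    MvPolynomial.aeval (fun i => Polynomial.C (ξ i : ℂ) * Polynomial.X) p with hR
  have hev : ∀ a : ℝ, R.eval (a : ℂ) = polyFn p (a • ξ) := by
    intro a
    rw [hR, ← Polynomial.coe_aeval_eq_eval, MvPolynomial.comp_aeval_apply, polyFn,
      MvPolynomial.aeval_eq_eval]
    refine congrArg (fun c : Fin d → ℂ => MvPolynomial.eval c p) (funext fun i => ?_)
    rw [map_mul, Polynomial.aeval_C, Polynomial.aeval_X, PiLp.smul_apply, smul_eq_mul,
      Complex.ofReal_mul, mul_comm]
    rfl
  have hone : R.eval ((1 : ℝ) : ℂ) ≠ 0 := by rwa [hev, one_smul]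
  simp_rw [← hev] at hlim
  by_cases hdeg : 0 < R.degree
  · have hz : Tendsto (fun a : ℝ => ‖(a : ℂ)‖) atTop atTop := by
      simpa only [Complex.norm_real, Real.norm_eq_abs] using tendsto_abs_atTop_atTop
    exact not_tendsto_atTop_of_tendsto_nhds hlim.norm (R.tendsto_norm_atTop hdeg hz)
  · rw [Polynomial.eq_C_of_degree_le_zero (not_lt.1 hdeg)] at hlim hone
    simp only [Polynomial.eval_C] at hlim hone
    exact hone (tendsto_nhds_unique tendsto_const_nhds hlim)

end Nonvanishing

section Conic

variable {d : ℕ} {V : Rd d → Rd d → ℂ}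

/-- The set of nonzero points of phase space near which a function `V` of `(x, ξ)` does not decay
rapidly along an open cone: the Gabor wave front set with `V` in place of `V_φ u`. -/
def conicSingularSet (V : Rd d → Rd d → ℂ) : Set (PhaseSpace d) :=
  {z₀ | z₀ ≠ 0 ∧ ¬ ∃ Γ : Set (PhaseSpace d), IsOpen Γ ∧ (0 : PhaseSpace d) ∉ Γ ∧
    (∀ z ∈ Γ, ∀ a : ℝ, 0 < a → a • z ∈ Γ) ∧ z₀ ∈ Γ ∧
    ∀ N : ℕ, ∃ C : ℝ, ∀ z ∈ Γ, bracket z ^ N * ‖V z.1 z.2‖ ≤ C}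

theorem gaborWF_eq_conicSingularSet (φ : 𝓢(Rd d, ℂ)) (u : 𝓢'(Rd d, ℂ)) :
    gaborWF φ u = conicSingularSet (stft φ u) := rfl

theorem bracket_swap (z : PhaseSpace d) : bracket z.swap = bracket z := by
  rw [bracket, bracket, Prod.fst_swap, Prod.snd_swap, add_right_comm]

theorem bracket_le (z : PhaseSpace d) : bracket z ≤ 1 + ‖z.1‖ + ‖z.2‖ := by
  refine Real.sqrt_le_iff.2 ⟨by positivity, ?_⟩
  nlinarith [norm_nonneg z.1, norm_nonneg z.2, mul_nonneg (norm_nonneg z.1) (norm_nonneg z.2)]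

theorem norm_snd_le_bracket (z : PhaseSpace d) : ‖z.2‖ ≤ bracket z :=
  Real.le_sqrt_of_sq_le (by nlinarith [sq_nonneg ‖z.1‖])

theorem swap_ne_zero_iff (z : PhaseSpace d) : z.swap ≠ 0 ↔ z ≠ 0 := by
  simp [Prod.ext_iff, and_comm]

theorem preimage_swap_conicSingularSet_subset (V : Rd d → Rd d → ℂ) :
    Prod.swap ⁻¹' conicSingularSet (fun ξ x => V x ξ) ⊆ conicSingularSet V := by
  rintro z ⟨hz, h⟩
  refine ⟨(swap_ne_zero_iff z).1 hz, fun ⟨Γ, hΓ, h0, hcone, hzΓ, hdec⟩ => h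
    ⟨Prod.swap ⁻¹' Γ, hΓ.preimage continuous_swap, h0, fun w hw a ha => hcone _ hw a ha, hzΓ,
      fun N => ?_⟩⟩
  obtain ⟨C, hC⟩ := hdec N
  exact ⟨C, fun w hw => bracket_swap w ▸ hC _ hw⟩

theorem conicSingularSet_flip (V : Rd d → Rd d → ℂ) :
    conicSingularSet V = Prod.swap ⁻¹' conicSingularSet (fun ξ x => V x ξ) :=
  Set.Subset.antisymm (fun z hz => preimage_swap_conicSingularSet_subset (fun ξ x => V x ξ)
    (Set.mem_preimage.2 (z.swap_swap.symm ▸ hz))) (preimage_swap_conicSingularSet_subset V)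

theorem isOpen_norm_snd_lt_mul_norm_fst (M : ℝ) :
    IsOpen {w : PhaseSpace d | ‖w.2‖ < M * ‖w.1‖} :=
  isOpen_lt (by fun_prop) (by fun_prop)

theorem bracket_pow_mul_le_of_norm_snd_le {M C v : ℝ} {N m : ℕ} {w : PhaseSpace d} (hv : 0 ≤ v)
    (hw : ‖w.2‖ ≤ M * ‖w.1‖) (hM : 0 ≤ M)
    (h : (1 + ‖w.1‖) ^ (N + m) * v ≤ C * (1 + ‖w.2‖) ^ m) :
    bracket w ^ N * v ≤ C * (1 + M) ^ (N + m) := by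
  have hC : 0 ≤ C := nonneg_of_mul_nonneg_left ((by positivity : (0 : ℝ) ≤ _).trans h)
    (by positivity)
  have hsnd : 1 + ‖w.2‖ ≤ (1 + M) * (1 + ‖w.1‖) := by nlinarith [norm_nonneg w.1]
  have hbracket : bracket w ≤ (1 + M) * (1 + ‖w.1‖) := by nlinarith [bracket_le w, norm_nonneg w.1]
  have hpos : 0 < (1 + ‖w.1‖) ^ m := by positivity
  refine le_of_mul_le_mul_right ?_ hpos
  calc bracket w ^ N * v * (1 + ‖w.1‖) ^ m
      ≤ ((1 + M) * (1 + ‖w.1‖)) ^ N * v * (1 + ‖w.1‖) ^ m := by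
        gcongr
        exact Real.sqrt_nonneg _
    _ = (1 + M) ^ N * ((1 + ‖w.1‖) ^ (N + m) * v) := by
        simp only [mul_pow, pow_add, mul_assoc, mul_comm v]
    _ ≤ (1 + M) ^ N * (C * ((1 + M) * (1 + ‖w.1‖)) ^ m) :=
        mul_le_mul_of_nonneg_left (h.trans (by gcongr)) (by positivity)
    _ = C * (1 + M) ^ (N + m) * (1 + ‖w.1‖) ^ m := by
        simp only [mul_pow, pow_add, mul_assoc, mul_left_comm]

theorem conicSingularSet_subset {m : ℕ}
    (hV : ∀ N : ℕ, ∃ C : ℝ, ∀ x ξ, (1 + ‖x‖) ^ N * ‖V x ξ‖ ≤ C * (1 + ‖ξ‖) ^ m) :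
    conicSingularSet V ⊆ {z | z.1 = 0 ∧ z.2 ≠ 0} := by
  rintro z ⟨hz, hsing⟩
  have hz1 : z.1 = 0 := by
    by_contra hz1
    have hpos : 0 < ‖z.1‖ := norm_pos_iff.2 hz1
    set M : ℝ := (‖z.2‖ + 1) / ‖z.1‖ with hM
    refine hsing ⟨_, isOpen_norm_snd_lt_mul_norm_fst M, by simp, fun w hw a ha => ?_, ?_,
      fun N => ?_⟩
    · simp only [Set.mem_ofPred_eq, Prod.smul_fst, Prod.smul_snd, norm_smul] at hw ⊢
      rw [mul_left_comm]
      exact mul_lt_mul_of_pos_left hw (norm_pos_iff.2 ha.ne')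
    · rw [Set.mem_ofPred_eq, hM, div_mul_cancel₀ _ hpos.ne']
      exact lt_add_one _
    · obtain ⟨C, hC⟩ := hV (N + m)
      exact ⟨C * (1 + M) ^ (N + m), fun w hw => bracket_pow_mul_le_of_norm_snd_le (norm_nonneg _)
        (Set.mem_ofPred_eq ▸ hw).le (by positivity) (hC w.1 w.2)⟩
  exact ⟨hz1, fun hz2 => hz (Prod.ext hz1 hz2)⟩

theorem subset_conicSingularSet {q : MvPolynomial (Fin d) ℂ} (hq : q ≠ 0) {x : Rd d}
    (hV : ∀ ξ, ‖V x ξ‖ = ‖polyFn q ξ‖) : {z | z.1 = 0 ∧ z.2 ≠ 0} ⊆ conicSingularSet V := by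
  rintro ⟨_, z₂⟩ ⟨rfl, hz₂⟩
  refine ⟨fun h => hz₂ (congrArg Prod.snd h), ?_⟩
  rintro ⟨Γ, hΓ, h0, hcone, hzΓ, hdec⟩
  obtain ⟨ξ, hξΓ, hξ⟩ := exists_mem_polyFn_ne_zero hq hΓ hzΓ
  have hξpos : 0 < ‖ξ‖ := norm_pos_iff.2 fun h => h0 (by rw [h] at hξΓ; exact hξΓ)
  obtain ⟨C, hC⟩ := hdec 1
  have hlim : Tendsto (fun a : ℝ => (a⁻¹ • x, ξ)) atTop (𝓝 ((0 : Rd d), ξ)) := by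
    refine Tendsto.prodMk_nhds ?_ tendsto_const_nhds
    simpa using (tendsto_inv_atTop_zero (𝕜 := ℝ)).smul_const x
  have hbound : Tendsto (fun a : ℝ => C / ‖ξ‖ * a⁻¹) atTop (𝓝 0) := by
    simpa using tendsto_inv_atTop_zero.const_mul (C / ‖ξ‖)
  refine not_tendsto_polyFn_smul hξ (squeeze_zero_norm' ?_ hbound)
  filter_upwards [hlim (hΓ.mem_nhds hξΓ), eventually_gt_atTop 0] with a ha hapos
  have hmem : (x, a • ξ) ∈ Γ := by
    simpa [smul_inv_smul₀ hapos.ne'] using hcone _ ha a hapos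
  have hle : a * ‖ξ‖ ≤ bracket (x, a • ξ) := by
    simpa [norm_smul, abs_of_pos hapos] using norm_snd_le_bracket (x, a • ξ)
  rw [← div_eq_mul_inv, div_div, le_div_iff₀ (by positivity), ← hV, mul_comm, mul_comm ‖ξ‖]
  exact (mul_le_mul_of_nonneg_right hle (norm_nonneg _)).trans (by simpa using hC _ hmem)

end Conic

section Anisotropic

variable {d : ℕ} {t s : ℝ} {V : Rd d → Rd d → ℂ}

/-- The set of nonzero points of phase space near which a function `V` of `(x, ξ)` does not decay
superexponentially along the curves `a ↦ (a ^ t x, a ^ s ξ)`: the `t,s`-Gelfand--Shilov wave front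
set with `V` in place of `V_ψ u`. -/
def anisotropicSingularSet (t s : ℝ) (V : Rd d → Rd d → ℂ) : Set (PhaseSpace d) :=
  {z₀ | z₀ ≠ 0 ∧ ¬ ∃ U : Set (PhaseSpace d), IsOpen U ∧ (0 : PhaseSpace d) ∉ U ∧ z₀ ∈ U ∧
    ∀ r : ℝ, 0 < r → ∃ C : ℝ, ∀ a : ℝ, 0 < a → ∀ z ∈ U,
      Real.exp (r * a) * ‖V (a ^ t • z.1) (a ^ s • z.2)‖ ≤ C}

theorem gelfandShilovWF_eq_anisotropicSingularSet (t s : ℝ) (ψ : 𝓢(Rd d, ℂ))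
    (u : 𝓢'(Rd d, ℂ)) :
    gelfandShilovWF t s ψ u = anisotropicSingularSet t s (stft ψ u) := rfl

theorem preimage_swap_anisotropicSingularSet_subset (t s : ℝ) (V : Rd d → Rd d → ℂ) :
    Prod.swap ⁻¹' anisotropicSingularSet s t (fun ξ x => V x ξ) ⊆
      anisotropicSingularSet t s V := by
  rintro z ⟨hz, h⟩
  refine ⟨(swap_ne_zero_iff z).1 hz, fun ⟨U, hU, h0, hzU, hdec⟩ => h
    ⟨Prod.swap ⁻¹' U, hU.preimage continuous_swap, h0, hzU, fun r hr => ?_⟩⟩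
  obtain ⟨C, hC⟩ := hdec r hr
  exact ⟨C, fun a ha w hw => hC a ha _ hw⟩

theorem anisotropicSingularSet_flip (t s : ℝ) (V : Rd d → Rd d → ℂ) :
    anisotropicSingularSet t s V =
      Prod.swap ⁻¹' anisotropicSingularSet s t (fun ξ x => V x ξ) :=
  Set.Subset.antisymm (fun z hz => preimage_swap_anisotropicSingularSet_subset s t
    (fun ξ x => V x ξ) (Set.mem_preimage.2 (z.swap_swap.symm ▸ hz)))
    (preimage_swap_anisotropicSingularSet_subset t s V)

theorem exists_one_add_rpow_mul_pow_le_exp (hs : 0 < s) {K : ℝ} (hK : 0 ≤ K) (m : ℕ) :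
    ∃ C : ℝ, ∀ a : ℝ, 0 < a → (1 + a ^ s * K) ^ m ≤ C * Real.exp a := by
  set ε : ℝ := 1 / (s * (m + 1)) with hε
  have hεpos : 0 < ε := by positivity
  refine ⟨(1 + ε⁻¹ ^ s * K) ^ m, fun a ha => ?_⟩
  have hlin : a ≤ ε⁻¹ * Real.exp (ε * a) := by
    rw [inv_mul_eq_div, le_div_iff₀ hεpos]
    linarith [Real.add_one_le_exp (ε * a)]
  have hrpow : a ^ s ≤ ε⁻¹ ^ s * Real.exp (a / (m + 1)) :=
    calc a ^ s ≤ (ε⁻¹ * Real.exp (ε * a)) ^ s := Real.rpow_le_rpow ha.le hlin hs.le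
      _ = ε⁻¹ ^ s * Real.exp (a / (m + 1)) := by
        rw [Real.mul_rpow (by positivity) (by positivity), ← Real.exp_mul]
        congr 2
        rw [hε]
        field_simp
  have hbase : 1 + a ^ s * K ≤ (1 + ε⁻¹ ^ s * K) * Real.exp (a / (m + 1)) := by
    have hone : 1 ≤ Real.exp (a / (m + 1)) := Real.one_le_exp (by positivity)
    nlinarith [mul_le_mul_of_nonneg_right hrpow hK]
  calc (1 + a ^ s * K) ^ m ≤ ((1 + ε⁻¹ ^ s * K) * Real.exp (a / (m + 1))) ^ m := by gcongr
    _ = (1 + ε⁻¹ ^ s * K) ^ m * Real.exp (m * (a / (m + 1))) := by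
      rw [mul_pow, ← Real.exp_nat_mul]
    _ ≤ (1 + ε⁻¹ ^ s * K) ^ m * Real.exp a := by
      gcongr
      rw [mul_div_assoc', div_le_iff₀ (by positivity)]
      nlinarith

theorem mul_le_mul_abs_smul_coord_rpow (ht : 0 < t) {δ r a : ℝ} (hδ : 0 < δ) (hr : 0 ≤ r)
    (ha : 0 < a) {x : Rd d} {j : Fin d} (hx : δ ≤ |x j|) :
    r * a ≤ r / δ ^ (1 / t) * |(a ^ t • x) j| ^ (1 / t) := by
  have hat : 0 < a ^ t := Real.rpow_pos_of_pos ha t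
  have hscale : |(a ^ t • x) j| ^ (1 / t) = a * |x j| ^ (1 / t) := by
    rw [PiLp.smul_apply, smul_eq_mul, abs_mul, abs_of_pos hat,
      Real.mul_rpow hat.le (abs_nonneg _), ← Real.rpow_mul ha.le, mul_one_div_cancel ht.ne',
      Real.rpow_one]
  have hle : δ ^ (1 / t) ≤ |x j| ^ (1 / t) := Real.rpow_le_rpow hδ.le hx (by positivity)
  rw [hscale, div_mul_eq_mul_div, le_div_iff₀ (by positivity), ← mul_assoc]
  exact mul_le_mul_of_nonneg_left hle (by positivity)

theorem exists_exp_mul_norm_smul_le (ht : 0 < t) (hs : 0 < s) {δ K r : ℝ} (hδ : 0 < δ)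
    (hK : 0 ≤ K) (hr : 0 ≤ r) {j : Fin d} {m : ℕ}
    (hV : ∃ C : ℝ, ∀ x ξ,
      Real.exp ((r + 1) / δ ^ (1 / t) * |x j| ^ (1 / t)) * ‖V x ξ‖ ≤ C * (1 + ‖ξ‖) ^ m) :
    ∃ C : ℝ, ∀ a : ℝ, 0 < a → ∀ x ξ : Rd d, δ ≤ |x j| → ‖ξ‖ ≤ K →
      Real.exp (r * a) * ‖V (a ^ t • x) (a ^ s • ξ)‖ ≤ C := by
  -- The additional `1` in the rate pays for the polynomial growth in the second variable.
  obtain ⟨C, hC⟩ := hV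
  obtain ⟨C', hC'⟩ := exists_one_add_rpow_mul_pow_le_exp hs hK m
  have hCnn : 0 ≤ C := nonneg_of_mul_nonneg_left ((by positivity : (0 : ℝ) ≤ _).trans (hC 0 0))
    (by positivity)
  refine ⟨C * C', fun a ha x ξ hx hξ => le_of_mul_le_mul_right ?_ (Real.exp_pos a)⟩
  have hξa : ‖a ^ s • ξ‖ ≤ a ^ s * K := by
    rw [norm_smul, Real.norm_of_nonneg (by positivity)]
    gcongr
  calc Real.exp (r * a) * ‖V (a ^ t • x) (a ^ s • ξ)‖ * Real.exp a
      = Real.exp ((r + 1) * a) * ‖V (a ^ t • x) (a ^ s • ξ)‖ := by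
        rw [add_mul, one_mul, Real.exp_add]; ring
    _ ≤ Real.exp ((r + 1) / δ ^ (1 / t) * |(a ^ t • x) j| ^ (1 / t)) *
          ‖V (a ^ t • x) (a ^ s • ξ)‖ := by
        gcongr ?_ * _
        exact Real.exp_le_exp.2 (mul_le_mul_abs_smul_coord_rpow ht hδ (by positivity) ha hx)
    _ ≤ C * (1 + ‖a ^ s • ξ‖) ^ m := hC _ _
    _ ≤ C * (1 + a ^ s * K) ^ m := by gcongr
    _ ≤ C * C' * Real.exp a := by
        rw [mul_assoc]
        exact mul_le_mul_of_nonneg_left (hC' a ha) hCnn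

theorem isOpen_lt_abs_coord_fst_inter_norm_snd_lt (δ K : ℝ) (j : Fin d) :
    IsOpen {w : PhaseSpace d | δ < |w.1 j| ∧ ‖w.2‖ < K} :=
  (isOpen_lt (f := fun _ : PhaseSpace d => δ) (g := fun w => |w.1 j|) (by fun_prop)
    (by fun_prop)).inter (isOpen_lt (f := fun w : PhaseSpace d => ‖w.2‖) (by fun_prop)
    continuous_const)

theorem anisotropicSingularSet_subset (ht : 0 < t) (hs : 0 < s) {m : ℕ}
    (hV : ∀ r : ℝ, 0 < r → ∀ j : Fin d, ∃ C : ℝ, ∀ x ξ,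
      Real.exp (r * |x j| ^ (1 / t)) * ‖V x ξ‖ ≤ C * (1 + ‖ξ‖) ^ m) :
    anisotropicSingularSet t s V ⊆ {z | z.1 = 0 ∧ z.2 ≠ 0} := by
  rintro z ⟨hz, hsing⟩
  have hz1 : z.1 = 0 := by
    by_contra hz1
    obtain ⟨j, hj⟩ : ∃ j, z.1 j ≠ 0 := by
      by_contra! hall
      exact hz1 (PiLp.ext hall)
    have hδ : 0 < |z.1 j| / 2 := by positivity
    refine hsing ⟨_, isOpen_lt_abs_coord_fst_inter_norm_snd_lt (|z.1 j| / 2) (‖z.2‖ + 1) j, ?_,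
      ⟨half_lt_self (abs_pos.2 hj), lt_add_one _⟩, fun r hr => ?_⟩
    · rintro ⟨h0, -⟩
      rw [Prod.fst_zero, PiLp.zero_apply, abs_zero] at h0
      exact h0.not_gt hδ
    · obtain ⟨C, hC⟩ := exists_exp_mul_norm_smul_le (K := ‖z.2‖ + 1) ht hs hδ (by positivity) hr.le
        (hV ((r + 1) / (|z.1 j| / 2) ^ (1 / t)) (by positivity) j)
      exact ⟨C, fun a ha w hw => hC a ha w.1 w.2 hw.1.le hw.2.le⟩
  exact ⟨hz1, fun hz2 => hz (Prod.ext hz1 hz2)⟩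

theorem subset_anisotropicSingularSet (ht : 0 < t) (hs : 0 < s) {q : MvPolynomial (Fin d) ℂ}
    (hq : q ≠ 0) {x : Rd d} (hV : ∀ ξ, ‖V x ξ‖ = ‖polyFn q ξ‖) :
    {z | z.1 = 0 ∧ z.2 ≠ 0} ⊆ anisotropicSingularSet t s V := by
  rintro ⟨_, z₂⟩ ⟨rfl, hz₂⟩
  refine ⟨fun h => hz₂ (congrArg Prod.snd h), ?_⟩
  rintro ⟨U, hU, -, hzU, hdec⟩
  obtain ⟨ξ, hξU, hξ⟩ := exists_mem_polyFn_ne_zero hq hU hzU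
  obtain ⟨C, hC⟩ := hdec 1 one_pos
  have hlim : Tendsto (fun a : ℝ => (a ^ (-t) • x, ξ)) atTop (𝓝 ((0 : Rd d), ξ)) := by
    refine Tendsto.prodMk_nhds ?_ tendsto_const_nhds
    simpa using (tendsto_rpow_neg_atTop ht).smul_const x
  have hdecay : Tendsto (fun a : ℝ => polyFn q (a ^ s • ξ)) atTop (𝓝 0) := by
    have hbound : Tendsto (fun a : ℝ => C * Real.exp (-a)) atTop (𝓝 0) := by
      simpa using Real.tendsto_exp_neg_atTop_nhds_zero.const_mul C
    refine squeeze_zero_norm' ?_ hbound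
    filter_upwards [hlim (hU.mem_nhds hξU), eventually_gt_atTop 0] with a ha hapos
    have hle := hC a hapos _ ha
    simp only [smul_smul, ← Real.rpow_add hapos, add_neg_cancel, Real.rpow_zero, one_smul,
      one_mul, hV] at hle
    rwa [Real.exp_neg, ← div_eq_mul_inv, le_div_iff₀ (Real.exp_pos a), mul_comm]
  refine not_tendsto_polyFn_smul hξ ((hdecay.comp
    (tendsto_rpow_atTop (one_div_pos.2 hs))).congr' ?_)
  filter_upwards [eventually_gt_atTop 0] with a ha
  rw [Function.comp_apply, ← Real.rpow_mul ha.le, one_div_mul_cancel hs.ne', Real.rpow_one]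

end Anisotropic

section Covariant

variable {d : ℕ} {t s : ℝ} {V : Rd d → Rd d → ℂ} {Φ : MvPolynomial (Fin d) ℂ →ₗ[ℂ] (Rd d → ℂ)}
  {p : MvPolynomial (Fin d) ℂ} {c : ℂ}

/-- Decay faster than every power of `‖x‖`, with no condition on derivatives. -/
def IsRapidlyDecreasing (A : Rd d → ℂ) : Prop :=
  ∀ N : ℕ, ∃ C : ℝ, ∀ x, (1 + ‖x‖) ^ N * ‖A x‖ ≤ C

/-- Decay faster than `exp (-r |x_j| ^ (1 / t))` for every `r` and `j`: the decay in `x` that a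
Gelfand--Shilov function of `Σ_t^s` has. -/
def IsSuperexponentiallyDecreasing (t : ℝ) (A : Rd d → ℂ) : Prop :=
  ∀ r : ℝ, 0 < r → ∀ j : Fin d, ∃ C : ℝ, ∀ x, Real.exp (r * |x j| ^ (1 / t)) * ‖A x‖ ≤ C

theorem exists_norm_eq_norm_polyFn (hc : c ≠ 0) (hp : p ≠ 0)
    (hV : ∀ x ξ, ‖V x ξ‖ = ‖c‖ * ‖Φ (translatePoly ξ p) x‖) {x : Rd d} (hx : Φ 1 x ≠ 0) :
    ∃ q : MvPolynomial (Fin d) ℂ, q ≠ 0 ∧ ∀ ξ, ‖V x ξ‖ = ‖polyFn q ξ‖ := by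
  obtain ⟨q, hq, hqV⟩ := exists_polyFn_eq_apply_translatePoly (c • LinearMap.proj x ∘ₗ Φ)
    (smul_ne_zero hc hx) hp
  refine ⟨q, hq, fun ξ => ?_⟩
  rw [hV, ← hqV, LinearMap.smul_apply, norm_smul, LinearMap.comp_apply, LinearMap.proj_apply]

theorem exists_weight_mul_norm_le_of_covariant {w : Rd d → ℝ} (hw : ∀ x, 0 ≤ w x)
    (hΦ : ∀ q, ∃ C : ℝ, ∀ x, w x * ‖Φ q x‖ ≤ C)
    (hV : ∀ x ξ, ‖V x ξ‖ = ‖c‖ * ‖Φ (translatePoly ξ p) x‖) :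
    ∃ C : ℝ, ∀ x ξ, w x * ‖V x ξ‖ ≤ C * (1 + ‖ξ‖) ^ (taylor p).totalDegree := by
  obtain ⟨C, hC⟩ := exists_weight_mul_norm_translatePoly_le Φ hw hΦ p
  refine ⟨‖c‖ * C, fun x ξ => ?_⟩
  rw [hV, mul_left_comm, mul_assoc]
  exact mul_le_mul_of_nonneg_left (hC x ξ) (norm_nonneg c)

theorem conicSingularSet_eq_of_covariant (hc : c ≠ 0) (hp : p ≠ 0)
    (hV : ∀ x ξ, ‖V x ξ‖ = ‖c‖ * ‖Φ (translatePoly ξ p) x‖) (hone : ∃ x, Φ 1 x ≠ 0)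
    (hΦ : ∀ q, IsRapidlyDecreasing (Φ q)) : conicSingularSet V = {z | z.1 = 0 ∧ z.2 ≠ 0} := by
  obtain ⟨x, hx⟩ := hone
  obtain ⟨q, hq, hqV⟩ := exists_norm_eq_norm_polyFn hc hp hV hx
  exact (conicSingularSet_subset fun N => exists_weight_mul_norm_le_of_covariant
    (fun x => by positivity) (fun q => hΦ q N) hV).antisymm (subset_conicSingularSet hq hqV)

theorem anisotropicSingularSet_eq_of_covariant (ht : 0 < t) (hs : 0 < s) (hc : c ≠ 0) (hp : p ≠ 0)
    (hV : ∀ x ξ, ‖V x ξ‖ = ‖c‖ * ‖Φ (translatePoly ξ p) x‖) (hone : ∃ x, Φ 1 x ≠ 0)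
    (hΦ : ∀ q, IsSuperexponentiallyDecreasing t (Φ q)) :
    anisotropicSingularSet t s V = {z | z.1 = 0 ∧ z.2 ≠ 0} := by
  obtain ⟨x, hx⟩ := hone
  obtain ⟨q, hq, hqV⟩ := exists_norm_eq_norm_polyFn hc hp hV hx
  exact (anisotropicSingularSet_subset ht hs fun r hr j => exists_weight_mul_norm_le_of_covariant
    (fun x => by positivity) (fun q => hΦ q r hr j) hV).antisymm
    (subset_anisotropicSingularSet ht hs hq hqV)

theorem exists_weight_mul_norm_le_of_mul_X {F X : Type*}
    {Φ : F → MvPolynomial (Fin d) ℂ →ₗ[ℂ] (X → ℂ)} {S : Fin d → F → F} {P : F → Prop} {w : X → ℝ}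
    (hw : ∀ x, 0 ≤ w x) (hΦ : ∀ q i f, Φ f (q * MvPolynomial.X i) = Φ (S i f) q)
    (hS : ∀ i f, P f → P (S i f)) (hone : ∀ f, P f → ∃ C : ℝ, ∀ x, w x * ‖Φ f 1 x‖ ≤ C)
    (q : MvPolynomial (Fin d) ℂ) {f : F} (hf : P f) : ∃ C : ℝ, ∀ x, w x * ‖Φ f q x‖ ≤ C := by
  induction q using MvPolynomial.induction_on generalizing f with
  | C a =>
    obtain ⟨C, hC⟩ := hone f hf
    refine ⟨‖a‖ * C, fun x => ?_⟩
    rw [← mul_one (MvPolynomial.C a), ← MvPolynomial.smul_eq_C_mul, map_smul, Pi.smul_apply,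
      norm_smul, mul_left_comm]
    exact mul_le_mul_of_nonneg_left (hC x) (norm_nonneg a)
  | add q₁ q₂ h₁ h₂ =>
    obtain ⟨C₁, hC₁⟩ := h₁ hf
    obtain ⟨C₂, hC₂⟩ := h₂ hf
    refine ⟨C₁ + C₂, fun x => ?_⟩
    rw [map_add, Pi.add_apply]
    calc w x * ‖Φ f q₁ x + Φ f q₂ x‖ ≤ w x * (‖Φ f q₁ x‖ + ‖Φ f q₂ x‖) :=
          mul_le_mul_of_nonneg_left (norm_add_le _ _) (hw x)
      _ ≤ C₁ + C₂ := by rw [mul_add]; exact add_le_add (hC₁ x) (hC₂ x)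
  | mul_X q i h =>
    rw [hΦ]
    exact h (hS i f hf)

end Covariant

section CoordD

variable {d : ℕ} {V : Type*} [LineDeriv (Rd d) V V]

/-- The operator `D_i = -i ∂_i`. -/
noncomputable def coordD [SMul ℂ V] (i : Fin d) (f : V) : V :=
  (-Complex.I) • ∂_{(EuclideanSpace.single i (1 : ℝ) : Rd d)} f

theorem foldr_iterate_add_single {ι W : Type*} {T : ι → W → W}
    (hT : ∀ i j, Function.Commute (T i) (T j)) (α : ι →₀ ℕ) {i : ι} {L : List ι} (hL : L.Nodup)
    (hi : i ∈ L) (w : W) :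
    L.foldr (fun j v => (T j)^[(α + Finsupp.single i 1 : ι →₀ ℕ) j] v) w =
      T i (L.foldr (fun j v => (T j)^[α j] v) w) := by
  have hne : ∀ {j}, i ≠ j → (α + Finsupp.single i 1 : ι →₀ ℕ) j = α j := fun h => by
    rw [Finsupp.add_apply, Finsupp.single_eq_of_ne h.symm, add_zero]
  induction L with
  | nil => exact absurd hi List.not_mem_nil
  | cons j L ih =>
    rw [List.nodup_cons] at hL
    rw [List.foldr_cons, List.foldr_cons]
    rcases eq_or_ne i j with rfl | hij
    · rw [Finsupp.add_apply, Finsupp.single_eq_same, Function.iterate_succ_apply',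
        List.foldr_ext _ (fun j v => (T j)^[α j] v) w fun j hj v => by
          rw [hne (ne_of_mem_of_not_mem hj hL.1).symm]]
    · rw [hne hij, ih hL.2 ((List.mem_cons.1 hi).resolve_left hij)]
      exact (hT j i).iterate_left _ _

theorem multiLength_add (α β : Fin d →₀ ℕ) :
    multiLength (α + β) = multiLength α + multiLength β := by
  simp [multiLength, Finset.sum_add_distrib]

theorem multiLength_single (i : Fin d) (k : ℕ) : multiLength (Finsupp.single i k) = k := by
  simp [multiLength, Finsupp.single_apply]

theorem multiD_zero [AddCommMonoid V] [Module ℂ V] (f : V) :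
    multiD (0 : Fin d →₀ ℕ) f = f := by
  simp [multiD, multiLength, List.foldr_fixed]

variable [AddCommGroup V] [Module ℂ V]

theorem coordD_add [LineDerivAdd (Rd d) V V] (i : Fin d) (f g : V) :
    coordD i (f + g) = coordD i f + coordD i g := by
  rw [coordD, LineDeriv.lineDerivOp_add, smul_add, coordD, coordD]

variable [LineDerivSMul ℂ (Rd d) V V]

theorem coordD_smul (i : Fin d) (c : ℂ) (f : V) : coordD i (c • f) = c • coordD i f := by
  rw [coordD, LineDeriv.lineDerivOp_smul, smul_comm, coordD]

theorem multiD_add_single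
    (hV : ∀ i j : Fin d, Function.Commute (coordD i : V → V) (coordD j)) (α : Fin d →₀ ℕ)
    (i : Fin d) (f : V) : multiD (α + Finsupp.single i 1) f = coordD i (multiD α f) := by
  have hcomm : ∀ i j, Function.Commute (fun w : V => ∂_{(EuclideanSpace.single i 1 : Rd d)} w)
      (fun w => ∂_{(EuclideanSpace.single j 1 : Rd d)} w) := fun i j f => by
    have hij := hV i j f
    simp only [coordD, LineDeriv.lineDerivOp_smul] at hij
    exact smul_right_injective V (neg_ne_zero.2 Complex.I_ne_zero)
      (smul_right_injective V (neg_ne_zero.2 Complex.I_ne_zero) hij)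
  rw [multiD, foldr_iterate_add_single hcomm α (List.nodup_finRange d) (List.mem_finRange i),
    multiLength_add, multiLength_single, pow_succ, mul_smul, multiD, coordD_smul, coordD]

theorem multiD_smul
    (hV : ∀ i j : Fin d, Function.Commute (coordD i : V → V) (coordD j)) (α : Fin d →₀ ℕ)
    (c : ℂ) (f : V) : multiD α (c • f) = c • multiD α f := by
  induction α using multiIndex_induction with
  | zero => rw [multiD_zero, multiD_zero]
  | add_single α i ih => rw [multiD_add_single hV, ih, coordD_smul, multiD_add_single hV]

theorem multiD_coordD
    (hV : ∀ i j : Fin d, Function.Commute (coordD i : V → V) (coordD j)) (α : Fin d →₀ ℕ)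
    (i : Fin d) (f : V) : multiD α (coordD i f) = multiD (α + Finsupp.single i 1) f := by
  rw [multiD_add_single hV]
  induction α using multiIndex_induction with
  | zero => rw [multiD_zero, multiD_zero]
  | add_single α j ih => rw [multiD_add_single hV, ih, multiD_add_single hV, (hV j i).eq]

end CoordD

section Schwartz

variable {d : ℕ}

theorem lineDerivOp_smulLeftCLM_apply {g : Rd d → ℂ} (hg : g.HasTemperateGrowth) (m : Rd d)
    (f : 𝓢(Rd d, ℂ)) (y : Rd d) :
    ∂_{m} (SchwartzMap.smulLeftCLM ℂ g f) y = g y * ∂_{m} f y + fderiv ℝ g y m * f y := by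
  have hdiff : DifferentiableAt ℝ g y := hg.1.differentiable (by simp) y
  rw [SchwartzMap.lineDerivOp_apply_eq_fderiv, SchwartzMap.lineDerivOp_apply_eq_fderiv,
    SchwartzMap.smulLeftCLM_apply hg]
  simp only [smul_eq_mul]
  rw [fderiv_fun_mul hdiff f.differentiableAt, add_apply, smul_apply, smul_apply, smul_eq_mul,
    smul_eq_mul, mul_comm (f y)]

theorem fderiv_planeWave (ξ y m : Rd d) :
    fderiv ℝ (planeWave ξ) y m = Complex.I * (inner ℝ m ξ : ℝ) * planeWave ξ y := by
  have hphase : HasFDerivAt (fun y : Rd d => Complex.I * ((inner ℝ y ξ : ℝ) : ℂ))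
      (Complex.I • (Complex.ofRealCLM ∘L (innerSL ℝ).flip ξ)) y :=
    ((Complex.ofRealCLM ∘L (innerSL ℝ).flip ξ).hasFDerivAt (x := y)).const_mul Complex.I
  have hwave : HasFDerivAt (planeWave ξ) _ y := hphase.cexp
  rw [hwave.fderiv, planeWave]
  simp [mul_comm, innerSL_apply_apply ℝ, real_inner_comm]

theorem coordD_modulation (i : Fin d) (ξ : Rd d) (f : 𝓢(Rd d, ℂ)) :
    coordD i (modulation ξ f) = modulation ξ (coordD i f) + (ξ i : ℂ) • modulation ξ f := by
  ext y
  rw [coordD, smul_apply, modulation,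
    lineDerivOp_smulLeftCLM_apply (planeWave_hasTemperateGrowth ξ), ← modulation,
    fderiv_planeWave, EuclideanSpace.inner_single_left]
  simp only [coordD, add_apply, smul_apply, smul_eq_mul, modulation_apply, map_one, one_mul]
  linear_combination (-(ξ i : ℂ) * planeWave ξ y * f y) * Complex.I_mul_I

theorem coordD_translation (i : Fin d) (x : Rd d) (f : 𝓢(Rd d, ℂ)) :
    coordD i (translation x f) = translation x (coordD i f) := by
  ext y
  have hcoe : (translation x f : Rd d → ℂ) = fun y => f (y - x) := rfl
  simp only [coordD, smul_apply, translation_apply, SchwartzMap.lineDerivOp_apply_eq_fderiv, hcoe,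
    fderiv_comp_sub]

theorem coordD_conjugate (i : Fin d) (f : 𝓢(Rd d, ℂ)) :
    coordD i (conjugate f) = -conjugate (coordD i f) := by
  ext y
  have hconj : HasFDerivAt (conjugate f) ((Complex.conjCLE : ℂ →L[ℝ] ℂ) ∘L fderiv ℝ f y) y :=
    ((Complex.conjCLE : ℂ →L[ℝ] ℂ).hasFDerivAt.comp y
      f.differentiableAt.hasFDerivAt).congr_of_eventuallyEq (.of_forall fun z => by simp)
  simp [coordD, SchwartzMap.lineDerivOp_apply_eq_fderiv, hconj.fderiv]

theorem commute_coordD_schwartz (i j : Fin d) :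
    Function.Commute (coordD i : 𝓢(Rd d, ℂ) → 𝓢(Rd d, ℂ)) (coordD j) := by
  intro f
  ext y
  have hdiff : DifferentiableAt ℝ (fderiv ℝ f) y :=
    ((f.smooth 2).fderiv_right (m := 1) (by norm_num)).differentiable (by norm_num) y
  have hsnd : ∀ v w : Rd d, ∂_{v} (∂_{w} f) y = fderiv ℝ (fderiv ℝ f) y v w := by
    intro v w
    have hcoe : ((∂_{w} f : 𝓢(Rd d, ℂ)) : Rd d → ℂ) = fun y => fderiv ℝ f y w :=
      funext (SchwartzMap.lineDerivOp_apply_eq_fderiv w f)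
    rw [SchwartzMap.lineDerivOp_apply_eq_fderiv, hcoe,
      fderiv_clm_apply hdiff (differentiableAt_const _)]
    simp
  simp only [coordD, LineDeriv.lineDerivOp_smul, smul_apply, hsnd]
  rw [(f.smooth 2).contDiffAt.isSymmSndFDerivAt (by simp)]

theorem coordD_distribution_apply (i : Fin d) (u : 𝓢'(Rd d, ℂ)) (f : 𝓢(Rd d, ℂ)) :
    coordD i u f = -u (coordD i f) := by
  rw [coordD, coordD, map_smul, ← smul_neg]
  exact congrArg ((-Complex.I) • ·)
    ((TemperedDistribution.lineDerivOp_apply_apply u f _).trans (map_neg _ _))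

theorem commute_coordD_distribution (i j : Fin d) :
    Function.Commute (coordD i : 𝓢'(Rd d, ℂ) → 𝓢'(Rd d, ℂ)) (coordD j) := by
  intro u
  ext f
  simp only [coordD_distribution_apply, (commute_coordD_schwartz i j).eq]

theorem multiD_conjugate (β : Fin d →₀ ℕ) (f : 𝓢(Rd d, ℂ)) :
    multiD β (conjugate f) = (-1 : ℂ) ^ multiLength β • conjugate (multiD β f) := by
  induction β using multiIndex_induction with
  | zero => simp [multiD_zero, multiLength]
  | add_single β i ih =>
    rw [multiD_add_single commute_coordD_schwartz, ih, coordD_smul, coordD_conjugate,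
      multiD_add_single commute_coordD_schwartz, multiLength_add, multiLength_single, pow_succ,
      mul_smul, neg_one_smul]

theorem norm_multiD_conjugate_apply (β : Fin d →₀ ℕ) (f : 𝓢(Rd d, ℂ)) (x : Rd d) :
    ‖multiD β (conjugate f) x‖ = ‖multiD β f x‖ := by
  simp [multiD_conjugate]

/-- Multiplication of a Schwartz function by the coordinate `y_i`. -/
noncomputable def coordMul (i : Fin d) (f : 𝓢(Rd d, ℂ)) : 𝓢(Rd d, ℂ) :=
  SchwartzMap.smulLeftCLM ℂ (fun y : Rd d => (y i : ℂ)) f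

theorem coord_hasTemperateGrowth (i : Fin d) :
    (fun y : Rd d => (y i : ℂ)).HasTemperateGrowth :=
  ContinuousLinearMap.hasTemperateGrowth
    (Complex.ofRealCLM ∘L (EuclideanSpace.proj (𝕜 := ℝ) i : Rd d →L[ℝ] ℝ))

@[simp]
theorem coordMul_apply (i : Fin d) (f : 𝓢(Rd d, ℂ)) (y : Rd d) :
    coordMul i f y = y i * f y := by
  simp [coordMul, SchwartzMap.smulLeftCLM_apply_apply (coord_hasTemperateGrowth i)]

theorem coordD_coordMul (i j : Fin d) (f : 𝓢(Rd d, ℂ)) :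
    coordD j (coordMul i f) =
      coordMul i (coordD j f) + (if i = j then -Complex.I else 0) • f := by
  ext y
  have hcoord : HasFDerivAt (fun y : Rd d => (y i : ℂ))
      (Complex.ofRealCLM ∘L (EuclideanSpace.proj (𝕜 := ℝ) i : Rd d →L[ℝ] ℝ)) y :=
    (Complex.ofRealCLM ∘L (EuclideanSpace.proj (𝕜 := ℝ) i : Rd d →L[ℝ] ℝ)).hasFDerivAt
  rw [coordD, smul_apply, coordMul, lineDerivOp_smulLeftCLM_apply (coord_hasTemperateGrowth i),
    hcoord.fderiv]
  split_ifs with h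
  · simp [coordD, h, mul_add, mul_left_comm]
  · simp [coordD, h, mul_left_comm]

end Schwartz

section AngularFourier

variable {d : ℕ}

theorem planeWave_zero_right (ξ : Rd d) : planeWave ξ 0 = 1 := by
  simp [planeWave]

theorem norm_planeWave (ξ y : Rd d) : ‖planeWave ξ y‖ = 1 := by
  simp [planeWave, Complex.norm_exp]

theorem planeWave_add_right (ξ x y : Rd d) :
    planeWave ξ (x + y) = planeWave ξ x * planeWave ξ y := by
  simp [planeWave, inner_add_left, mul_add, Complex.exp_add]

/-- The Fourier transform with the normalization `ξ ↦ ∫ exp (-i ⟨y, ξ⟩) f(y) dy`, expressed through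
Mathlib's `𝓕`, whose kernel is `exp (-2πi ⟨y, ξ⟩)`. -/
noncomputable def angularFourier (ξ : Rd d) (f : 𝓢(Rd d, ℂ)) : ℂ :=
  𝓕 f ((2 * Real.pi)⁻¹ • ξ)

theorem angularFourier_eq_integral (ξ : Rd d) (f : 𝓢(Rd d, ℂ)) :
    angularFourier ξ f = ∫ y, modulation (-ξ) f y := by
  rw [angularFourier, SchwartzMap.fourier_coe, Real.fourier_eq']
  refine integral_congr_ae (.of_forall fun y => ?_)
  simp only [modulation_apply, planeWave, smul_eq_mul, inner_smul_right, inner_neg_right]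
  congr 2
  have hpi : (Real.pi : ℂ) ≠ 0 := by exact_mod_cast Real.pi_ne_zero
  push_cast
  field_simp

theorem norm_angularFourier_le (ξ : Rd d) (f : 𝓢(Rd d, ℂ)) :
    ‖angularFourier ξ f‖ ≤ ∫ y, ‖f y‖ := by
  rw [angularFourier_eq_integral]
  refine (norm_integral_le_integral_norm _).trans_eq (integral_congr_ae (.of_forall fun y => ?_))
  simp [norm_planeWave]

theorem angularFourier_coordD (i : Fin d) (ξ : Rd d) (f : 𝓢(Rd d, ℂ)) :
    angularFourier ξ (coordD i f) = ξ i * angularFourier ξ f := by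
  have hinner : (inner ℝ · (EuclideanSpace.single i (1 : ℝ) : Rd d)).HasTemperateGrowth :=
    ((innerSL ℝ).flip (EuclideanSpace.single i (1 : ℝ) : Rd d)).hasTemperateGrowth
  have hpi : (Real.pi : ℂ) ≠ 0 := by exact_mod_cast Real.pi_ne_zero
  rw [angularFourier, coordD, FourierTransform.fourier_smul, SchwartzMap.fourier_lineDerivOp_eq,
    smul_apply, smul_apply, SchwartzMap.smulLeftCLM_apply_apply hinner, angularFourier,
    EuclideanSpace.inner_single_right]
  generalize 𝓕 f ((2 * Real.pi)⁻¹ • ξ) = F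
  simp only [PiLp.smul_apply, smul_eq_mul, Complex.real_smul, conj_trivial, one_mul]
  push_cast
  field_simp
  linear_combination (-(ξ i : ℂ) * F) * Complex.I_sq

theorem exists_angularFourier_ne_zero {f : 𝓢(Rd d, ℂ)} (hf : f ≠ 0) :
    ∃ ξ, angularFourier ξ f ≠ 0 := by
  by_contra! h
  have hfourier : 𝓕 f = 0 := by
    ext η
    have hη := h ((2 * Real.pi) • η)
    rwa [angularFourier, inv_smul_smul₀ (by positivity)] at hη
  refine hf ?_
  rw [← FourierTransform.fourierInv_fourier_eq (F := 𝓢(Rd d, ℂ)) f, hfourier,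
    FourierTransform.fourierInv_zero]

theorem isRapidlyDecreasing_schwartz (f : 𝓢(Rd d, ℂ)) : IsRapidlyDecreasing f := fun N =>
  ⟨_, fun x => by
    simpa using SchwartzMap.one_add_le_sup_seminorm_apply (𝕜 := ℝ) (m := (N, 0)) (k := N) (n := 0)
      le_rfl le_rfl f x⟩

theorem isRapidlyDecreasing_angularFourier (f : 𝓢(Rd d, ℂ)) :
    IsRapidlyDecreasing fun ξ => angularFourier ξ f := by
  intro N
  obtain ⟨C, hC⟩ := isRapidlyDecreasing_schwartz (𝓕 f) N
  refine ⟨(2 * Real.pi) ^ N * C, fun ξ => ?_⟩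
  have hle : 1 + ‖ξ‖ ≤ 2 * Real.pi * (1 + ‖(2 * Real.pi)⁻¹ • ξ‖) := by
    rw [norm_smul, Real.norm_of_nonneg (by positivity), mul_add, mul_one,
      mul_inv_cancel_left₀ (by positivity)]
    linarith [Real.two_le_pi]
  calc (1 + ‖ξ‖) ^ N * ‖angularFourier ξ f‖
      ≤ (2 * Real.pi * (1 + ‖(2 * Real.pi)⁻¹ • ξ‖)) ^ N * ‖angularFourier ξ f‖ := by gcongr
    _ = (2 * Real.pi) ^ N * ((1 + ‖(2 * Real.pi)⁻¹ • ξ‖) ^ N * ‖angularFourier ξ f‖) := by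
      rw [mul_pow, mul_assoc]
    _ ≤ (2 * Real.pi) ^ N * C := mul_le_mul_of_nonneg_left (hC _) (by positivity)

theorem conjugate_modulation_translation (x ξ : Rd d) (f : 𝓢(Rd d, ℂ)) :
    conjugate (modulation ξ (translation x f)) =
      modulation (-ξ) (translation x (conjugate f)) := by
  ext y
  simp [planeWave, ← Complex.exp_conj]

theorem modulation_translation (x ξ : Rd d) (f : 𝓢(Rd d, ℂ)) :
    modulation ξ (translation x f) = planeWave ξ x • translation x (modulation ξ f) := by
  ext y
  simp only [modulation_apply, translation_apply, smul_apply, smul_eq_mul]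
  rw [← mul_assoc, ← planeWave_add_right, add_sub_cancel]

theorem conjugate_ne_zero {f : 𝓢(Rd d, ℂ)} (hf : f ≠ 0) : conjugate f ≠ 0 := by
  refine fun h => hf (SchwartzMap.ext fun y => ?_)
  simpa using DFunLike.congr_fun h y

end AngularFourier

section LinearFamily

variable {d : ℕ}

theorem apply_eq_apply_translatePoly {U : MvPolynomial (Fin d) ℂ →ₗ[ℂ] 𝓢'(Rd d, ℂ)}
    {S : Fin d → 𝓢(Rd d, ℂ) → 𝓢(Rd d, ℂ)} {M : 𝓢(Rd d, ℂ) → 𝓢(Rd d, ℂ)} {ξ : Rd d}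
    (hU : ∀ q i f, U (q * MvPolynomial.X i) f = U q (S i f))
    (hM : ∀ i f, S i (M f) = M (S i f) + (ξ i : ℂ) • M f) (hone : ∀ f, U 1 (M f) = U 1 f)
    (p : MvPolynomial (Fin d) ℂ) (f : 𝓢(Rd d, ℂ)) : U p (M f) = U (translatePoly ξ p) f := by
  induction p using MvPolynomial.induction_on generalizing f with
  | C a =>
    rw [← mul_one (MvPolynomial.C a), ← MvPolynomial.smul_eq_C_mul, map_smul, map_smul,
      map_one (translatePoly ξ), map_smul, smul_apply, smul_apply, hone]
  | add p q hp hq => rw [map_add, map_add, map_add, add_apply, add_apply, hp, hq]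
  | mul_X p i h =>
    rw [hU, hM, map_add, map_smul, h, h, map_mul, translatePoly_X, mul_add, map_add, add_apply,
      hU, mul_comm _ (MvPolynomial.C _), ← MvPolynomial.smul_eq_C_mul, map_smul, smul_apply]

/-- The functions `x ↦ U q (T x f)`, linear in the polynomial `q`, for a family `U` of distributions
that is linear in `q` and a family `T` of operators. -/
noncomputable def coefficientMap (U : MvPolynomial (Fin d) ℂ →ₗ[ℂ] 𝓢'(Rd d, ℂ))
    (T : Rd d → 𝓢(Rd d, ℂ) → 𝓢(Rd d, ℂ)) (f : 𝓢(Rd d, ℂ)) :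
    MvPolynomial (Fin d) ℂ →ₗ[ℂ] (Rd d → ℂ) where
  toFun q x := U q (T x f)
  map_add' q₁ q₂ := by ext x; rw [map_add, add_apply, Pi.add_apply]
  map_smul' c q := by ext x; rw [map_smul, smul_apply, Pi.smul_apply, RingHom.id_apply]

theorem coefficientMap_apply (U : MvPolynomial (Fin d) ℂ →ₗ[ℂ] 𝓢'(Rd d, ℂ))
    (T : Rd d → 𝓢(Rd d, ℂ) → 𝓢(Rd d, ℂ)) (f : 𝓢(Rd d, ℂ)) (q : MvPolynomial (Fin d) ℂ)
    (x : Rd d) : coefficientMap U T f q x = U q (T x f) := rfl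

theorem coefficientMap_mul_X {U : MvPolynomial (Fin d) ℂ →ₗ[ℂ] 𝓢'(Rd d, ℂ)}
    {T : Rd d → 𝓢(Rd d, ℂ) → 𝓢(Rd d, ℂ)} {S : Fin d → 𝓢(Rd d, ℂ) → 𝓢(Rd d, ℂ)}
    (hU : ∀ q i f, U (q * MvPolynomial.X i) f = U q (S i f))
    (hST : ∀ i x f, S i (T x f) = T x (S i f)) (q : MvPolynomial (Fin d) ℂ) (i : Fin d)
    (f : 𝓢(Rd d, ℂ)) :
    coefficientMap U T f (q * MvPolynomial.X i) = coefficientMap U T (S i f) q := by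
  ext x
  rw [coefficientMap_apply, coefficientMap_apply, hU, hST]

end LinearFamily

section DiracFamily

variable {d : ℕ}

/-- The map `q ↦ q(D) f`, as a linear map. -/
noncomputable def polyD {V : Type*} [AddCommGroup V] [Module ℂ V] [LineDeriv (Rd d) V V] (f : V) :
    MvPolynomial (Fin d) ℂ →ₗ[ℂ] V :=
  (MvPolynomial.basisMonomials (Fin d) ℂ).constr ℂ fun α => multiD α f

theorem polyD_monomial {V : Type*} [AddCommGroup V] [Module ℂ V] [LineDeriv (Rd d) V V] (f : V)
    (α : Fin d →₀ ℕ) (c : ℂ) : polyD f (MvPolynomial.monomial α c) = c • multiD α f := by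
  rw [← mul_one c, ← smul_eq_mul, ← MvPolynomial.smul_monomial, map_smul, smul_eq_mul, mul_one]
  exact congrArg (c • ·) ((MvPolynomial.basisMonomials (Fin d) ℂ).constr_basis ℂ _ α)

theorem polyD_mul_X_apply (u : 𝓢'(Rd d, ℂ)) (q : MvPolynomial (Fin d) ℂ) (i : Fin d)
    (f : 𝓢(Rd d, ℂ)) : polyD u (q * MvPolynomial.X i) f = polyD u q (-coordD i f) := by
  induction q using MvPolynomial.induction_on' with
  | monomial α c =>
    rw [MvPolynomial.X, MvPolynomial.monomial_mul, mul_one, polyD_monomial, polyD_monomial,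
      multiD_add_single commute_coordD_distribution, smul_apply, smul_apply,
      coordD_distribution_apply, map_neg]
  | add q₁ q₂ h₁ h₂ => rw [add_mul, map_add, map_add, add_apply, add_apply, h₁, h₂]

/-- The map `q ↦ q(D) δ_0`, as a linear map. -/
noncomputable def diracMap : MvPolynomial (Fin d) ℂ →ₗ[ℂ] 𝓢'(Rd d, ℂ) :=
  polyD (TemperedDistribution.delta (0 : Rd d))

theorem diracMap_apply (q : MvPolynomial (Fin d) ℂ) : diracMap q = diracCombination q := by
  conv_lhs => rw [q.as_sum]
  rw [map_sum, diracCombination]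
  exact Finset.sum_congr rfl fun α _ => polyD_monomial _ α _

theorem diracMap_one_apply (f : 𝓢(Rd d, ℂ)) : diracMap 1 f = f 0 := by
  rw [diracMap, ← MvPolynomial.C_1, ← MvPolynomial.monomial_zero', polyD_monomial, one_smul,
    multiD_zero, TemperedDistribution.delta_apply]

theorem diracMap_modulation (p : MvPolynomial (Fin d) ℂ) (ξ : Rd d) (f : 𝓢(Rd d, ℂ)) :
    diracMap p (modulation (-ξ) f) = diracMap (translatePoly ξ p) f := by
  refine apply_eq_apply_translatePoly (U := diracMap) (polyD_mul_X_apply _) (fun i f => ?_)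
    (fun f => ?_) p f
  · rw [coordD_modulation, PiLp.neg_apply, Complex.ofReal_neg, neg_smul, neg_add, neg_neg]
    congr 1
    exact (map_neg (SchwartzMap.smulLeftCLM ℂ (planeWave (-ξ))) _).symm
  · rw [diracMap_one_apply, diracMap_one_apply, modulation_apply, planeWave_zero_right, one_mul]

theorem norm_stft_diracCombination (p : MvPolynomial (Fin d) ℂ) (φ : 𝓢(Rd d, ℂ)) (x ξ : Rd d) :
    ‖stft φ (diracCombination p) x ξ‖ = ‖(((2 * Real.pi) ^ (-(d : ℝ) / 2) : ℝ) : ℂ)‖ *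
      ‖coefficientMap diracMap translation (conjugate φ) (translatePoly ξ p) x‖ := by
  rw [stft, sesqAction, conjugate_modulation_translation, ← diracMap_apply, diracMap_modulation,
    norm_mul, coefficientMap_apply]

end DiracFamily

section PolynomialFamily

variable {d : ℕ}

theorem polyDistribution_apply (p : MvPolynomial (Fin d) ℂ) (f : 𝓢(Rd d, ℂ)) :
    polyDistribution p f = ∫ y, f y * polyFn p y := rfl

theorem integrable_mul_polyFn (p : MvPolynomial (Fin d) ℂ) (f : 𝓢(Rd d, ℂ)) :
    Integrable fun y => f y * polyFn p y := by
  have hint := (SchwartzMap.smulLeftCLM ℂ (polyFn p) f).integrable (μ := volume)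
  rw [SchwartzMap.smulLeftCLM_apply (polyFn_hasTemperateGrowth p)] at hint
  simpa only [smul_eq_mul, mul_comm] using hint

/-- The map `polyDistribution`, as a linear map. -/
noncomputable def polyMap : MvPolynomial (Fin d) ℂ →ₗ[ℂ] 𝓢'(Rd d, ℂ) where
  toFun := polyDistribution
  map_add' p q := by
    ext f
    simp only [add_apply, polyDistribution_apply]
    rw [← integral_add (integrable_mul_polyFn p f) (integrable_mul_polyFn q f)]
    simp only [polyFn, map_add, mul_add]
  map_smul' c p := by
    ext f
    simp only [smul_apply, polyDistribution_apply, smul_eq_mul, RingHom.id_apply]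
    rw [← integral_const_mul]
    simp only [polyFn, MvPolynomial.smul_eval, mul_left_comm]

theorem polyMap_apply (p : MvPolynomial (Fin d) ℂ) : polyMap p = polyDistribution p := rfl

theorem polyMap_one_apply (f : 𝓢(Rd d, ℂ)) : polyMap 1 f = ∫ y, f y := by
  rw [polyMap_apply, polyDistribution_apply]
  simp only [polyFn, map_one, mul_one]

theorem polyMap_mul_X_apply (q : MvPolynomial (Fin d) ℂ) (i : Fin d) (f : 𝓢(Rd d, ℂ)) :
    polyMap (q * MvPolynomial.X i) f = polyMap q (coordMul i f) := by
  rw [polyMap_apply, polyMap_apply, polyDistribution_apply, polyDistribution_apply]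
  simp only [polyFn, map_mul, MvPolynomial.eval_X, coordMul_apply, mul_left_comm, mul_comm,
    mul_assoc]

theorem polyMap_translation (p : MvPolynomial (Fin d) ℂ) (x : Rd d) (f : 𝓢(Rd d, ℂ)) :
    polyMap p (translation x f) = polyMap (translatePoly x p) f := by
  refine apply_eq_apply_translatePoly polyMap_mul_X_apply (fun i f => ?_) (fun f => ?_) p f
  · ext y
    simp only [coordMul_apply, translation_apply, add_apply, smul_apply, smul_eq_mul,
      PiLp.sub_apply, Complex.ofReal_sub]
    ring
  · simp only [polyMap_one_apply, translation_apply]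
    exact integral_sub_right_eq_self _ x

theorem norm_stft_polyDistribution (p : MvPolynomial (Fin d) ℂ) (φ : 𝓢(Rd d, ℂ)) (x ξ : Rd d) :
    ‖stft φ (polyDistribution p) x ξ‖ = ‖(((2 * Real.pi) ^ (-(d : ℝ) / 2) : ℝ) : ℂ)‖ *
      ‖coefficientMap polyMap (fun ξ => modulation (-ξ)) (conjugate φ) (translatePoly x p) ξ‖ := by
  rw [stft, sesqAction, conjugate_modulation_translation, modulation_translation, map_smul,
    ← polyMap_apply, polyMap_translation, norm_mul, norm_smul, norm_planeWave, one_mul,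
    coefficientMap_apply]

end PolynomialFamily

section GevreyWeight

variable {d : ℕ} {h h' t s r : ℝ}

theorem multiFactorial_pos (α : Fin d →₀ ℕ) : 0 < multiFactorial α :=
  Finset.prod_pos fun _ _ => Nat.factorial_pos _

theorem multiFactorial_single (i : Fin d) (k : ℕ) :
    multiFactorial (Finsupp.single i k) = k.factorial := by
  rw [multiFactorial, Finset.prod_eq_single_of_mem i (Finset.mem_univ i), Finsupp.single_eq_same]
  exact fun j _ hj => by rw [Finsupp.single_eq_of_ne hj, Nat.factorial_zero]

theorem multiFactorial_add_single (α : Fin d →₀ ℕ) (i : Fin d) :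
    multiFactorial (α + Finsupp.single i 1) = (α i + 1) * multiFactorial α := by
  simp only [multiFactorial, ← Finset.mul_prod_erase _ _ (Finset.mem_univ i), Finsupp.add_apply,
    Finsupp.single_eq_same, Nat.factorial_succ, mul_assoc]
  congr 2
  refine Finset.prod_congr rfl fun j hj => ?_
  rw [Finsupp.single_eq_of_ne (Finset.ne_of_mem_erase hj), add_zero]

theorem monomialFn_single (i : Fin d) (k : ℕ) (x : Rd d) :
    monomialFn (Finsupp.single i k) x = x i ^ k := by
  simp [monomialFn, Finsupp.single_apply, pow_ite]

theorem monomialFn_add_single (α : Fin d →₀ ℕ) (i : Fin d) (x : Rd d) :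
    monomialFn (α + Finsupp.single i 1) x = monomialFn α x * x i := by
  have hadd : monomialFn (α + Finsupp.single i 1) x =
      monomialFn α x * monomialFn (Finsupp.single i 1) x := by
    simp only [monomialFn, Finsupp.add_apply, pow_add, Finset.prod_mul_distrib]
  rw [hadd, monomialFn_single, pow_one]

theorem succ_apply_le_two_pow (α : Fin d →₀ ℕ) (i : Fin d) :
    (α i : ℝ) + 1 ≤ 2 ^ (multiLength α + 1) := by
  have hle : α i ≤ multiLength α :=
    Finset.single_le_sum (fun j _ => Nat.zero_le (α j)) (Finset.mem_univ i)
  exact_mod_cast ((Nat.succ_le_succ hle).trans_lt Nat.lt_two_pow_self).le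

/-- The weight `h^|α| α!^t` of the Gelfand--Shilov seminorms. -/
noncomputable def gevreyWeight (h t : ℝ) (α : Fin d →₀ ℕ) : ℝ :=
  h ^ multiLength α * (multiFactorial α : ℝ) ^ t

theorem gevreyWeight_pos (hh : 0 < h) (α : Fin d →₀ ℕ) : 0 < gevreyWeight h t α := by
  have := multiFactorial_pos α
  unfold gevreyWeight
  positivity

theorem gevreyWeight_mono (hh' : 0 ≤ h') (hle : h' ≤ h) (α : Fin d →₀ ℕ) :
    gevreyWeight h' t α ≤ gevreyWeight h t α := by
  unfold gevreyWeight
  gcongr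

theorem gevreyWeight_single (i : Fin d) (k : ℕ) :
    gevreyWeight h t (Finsupp.single i k) = h ^ k * (k.factorial : ℝ) ^ t := by
  rw [gevreyWeight, multiLength_single, multiFactorial_single]

theorem gevreyWeight_add_single (α : Fin d →₀ ℕ) (i : Fin d) :
    gevreyWeight h t (α + Finsupp.single i 1) = h * (α i + 1 : ℝ) ^ t * gevreyWeight h t α := by
  rw [gevreyWeight, gevreyWeight, multiLength_add, multiLength_single, multiFactorial_add_single,
    Nat.cast_mul, Real.mul_rpow (Nat.cast_nonneg _) (Nat.cast_nonneg _), Nat.cast_succ]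
  ring

theorem gevreyWeight_div_two_rpow (α : Fin d →₀ ℕ) :
    gevreyWeight (h / 2 ^ t) t α = gevreyWeight h t α / ((2 : ℝ) ^ multiLength α) ^ t := by
  rw [gevreyWeight, gevreyWeight, div_pow, Real.rpow_pow_comm zero_le_two, div_mul_eq_mul_div]

theorem gevreyWeight_div_two_rpow_add_single_le (hh : 0 < h) (ht : 0 ≤ t) (α : Fin d →₀ ℕ)
    (i : Fin d) :
    gevreyWeight (h / 2 ^ t) t (α + Finsupp.single i 1) ≤ h * gevreyWeight h t α := by
  have hweight := gevreyWeight_pos (t := t) hh α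
  rw [gevreyWeight_div_two_rpow, gevreyWeight_add_single, multiLength_add, multiLength_single,
    div_le_iff₀ (by positivity)]
  calc h * (α i + 1 : ℝ) ^ t * gevreyWeight h t α
      ≤ h * ((2 : ℝ) ^ (multiLength α + 1)) ^ t * gevreyWeight h t α := by
        gcongr; exact succ_apply_le_two_pow α i
    _ = h * gevreyWeight h t α * ((2 : ℝ) ^ (multiLength α + 1)) ^ t := mul_right_comm _ _ _

theorem succ_apply_mul_gevreyWeight_div_two_le (hh : 0 < h) (ht : 0 ≤ t) (α : Fin d →₀ ℕ)
    (i : Fin d) :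
    (α i + 1 : ℝ) * gevreyWeight (h / 2) t α ≤
      2 / h * gevreyWeight h t (α + Finsupp.single i 1) := by
  have hweight := gevreyWeight_pos (t := t) hh α
  have hone : 1 ≤ (α i + 1 : ℝ) ^ t := Real.one_le_rpow (by simp) ht
  calc (α i + 1 : ℝ) * gevreyWeight (h / 2) t α
      ≤ 2 ^ (multiLength α + 1) * gevreyWeight (h / 2) t α := by
        gcongr
        · exact (gevreyWeight_pos (by positivity) α).le
        · exact succ_apply_le_two_pow α i
    _ = 2 * gevreyWeight h t α := by
        rw [gevreyWeight, gevreyWeight, div_pow, pow_succ]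
        field_simp
    _ ≤ 2 * gevreyWeight h t α * (α i + 1 : ℝ) ^ t := le_mul_of_one_le_right (by positivity) hone
    _ = 2 / h * gevreyWeight h t (α + Finsupp.single i 1) := by
        rw [gevreyWeight_add_single]
        field_simp

theorem exp_mul_le_of_forall_pow_mul_le {ρ z b C : ℝ} (hρ : 0 < ρ)
    (hz : ∀ k : ℕ, z ^ k * b ≤ C * ((2 * ρ)⁻¹ ^ k * k.factorial)) :
    Real.exp (ρ * z) * b ≤ 2 * C := by
  have hterm : ∀ k : ℕ, (ρ * z) ^ k / k.factorial * b ≤ (1 / 2) ^ k * C := fun k => by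
    calc (ρ * z) ^ k / k.factorial * b = ρ ^ k / k.factorial * (z ^ k * b) := by
          rw [mul_pow]; ring
      _ ≤ ρ ^ k / k.factorial * (C * ((2 * ρ)⁻¹ ^ k * k.factorial)) :=
          mul_le_mul_of_nonneg_left (hz k) (by positivity)
      _ = (1 / 2) ^ k * C := by
          have : (k.factorial : ℝ) ≠ 0 := mod_cast k.factorial_ne_zero
          rw [inv_pow, mul_pow, div_pow]; field_simp; simp
  have hexp : HasSum (fun k : ℕ => (ρ * z) ^ k / (k.factorial : ℝ)) (Real.exp (ρ * z)) := by
    rw [Real.exp_eq_exp_ℝ]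
    exact NormedSpace.expSeries_div_hasSum_exp (ρ * z)
  exact hasSum_le hterm (hexp.mul_right b) (hasSum_geometric_two.mul_right C)

theorem exp_mul_rpow_mul_le_of_forall_pow_mul_le {C y b : ℝ} (ht : 0 < t) (hr : 0 < r)
    (hy : 0 ≤ y) (hb : 0 ≤ b)
    (hyb : ∀ k : ℕ, y ^ k * b ≤ C * (((2 * (r / t))⁻¹ ^ t) ^ k * (k.factorial : ℝ) ^ t)) :
    Real.exp (r * y ^ (1 / t)) * b ≤ 2 ^ t * C := by
  have hC : 0 ≤ C := hb.trans (by simpa using hyb 0)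
  have hroot : ∀ {a : ℝ}, 0 ≤ a → (a ^ (1 / t)) ^ t = a := fun ha => by
    rw [one_div, Real.rpow_inv_rpow ha ht.ne']
  have hexp : Real.exp (r / t * y ^ (1 / t)) * b ^ (1 / t) ≤ 2 * C ^ (1 / t) := by
    refine exp_mul_le_of_forall_pow_mul_le (by positivity) fun k => ?_
    refine (Real.rpow_le_rpow_iff (by positivity) (by positivity) ht).1 ?_
    rw [Real.mul_rpow (by positivity) (by positivity),
      Real.mul_rpow (by positivity) (by positivity),
      Real.mul_rpow (by positivity) (by positivity), ← Real.rpow_pow_comm (by positivity),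
      ← Real.rpow_pow_comm (by positivity), hroot hy, hroot hb, hroot hC]
    exact hyb k
  calc Real.exp (r * y ^ (1 / t)) * b
      = (Real.exp (r / t * y ^ (1 / t)) * b ^ (1 / t)) ^ t := by
        rw [Real.mul_rpow (by positivity) (by positivity), hroot hb, ← Real.exp_mul]
        field_simp
    _ ≤ (2 * C ^ (1 / t)) ^ t := by gcongr
    _ = 2 ^ t * C := by rw [Real.mul_rpow (by positivity) (by positivity), hroot hC]

theorem isSuperexponentiallyDecreasing_of_forall_pow_mul_le (ht : 0 < t) {A : Rd d → ℂ}
    (hA : ∀ h : ℝ, 0 < h → ∀ j : Fin d, ∃ C : ℝ, ∀ (k : ℕ) (x : Rd d),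
      |x j| ^ k * ‖A x‖ ≤ C * gevreyWeight h t (Finsupp.single j k)) :
    IsSuperexponentiallyDecreasing t A := by
  intro r hr j
  obtain ⟨C, hC⟩ := hA ((2 * (r / t))⁻¹ ^ t) (by positivity) j
  refine ⟨2 ^ t * C, fun x => ?_⟩
  refine exp_mul_rpow_mul_le_of_forall_pow_mul_le ht hr (abs_nonneg _) (norm_nonneg _) fun k => ?_
  rw [← gevreyWeight_single j]
  exact hC k x

end GevreyWeight

section GelfandShilov

variable {d : ℕ} {h t s : ℝ} {f g : 𝓢(Rd d, ℂ)}

theorem isGelfandShilov_iff : IsGelfandShilov t s f ↔ ∀ h : ℝ, 0 < h → ∃ C : ℝ,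
    ∀ (α β : Fin d →₀ ℕ) (x : Rd d),
      |monomialFn α x| * ‖multiD β f x‖ ≤ C * (gevreyWeight h t α * gevreyWeight h s β) := by
  refine forall₂_congr fun h hh => exists_congr fun C => forall₃_congr fun α β x => ?_
  have hweight : h ^ multiLength (α + β) * (multiFactorial α : ℝ) ^ t * (multiFactorial β : ℝ) ^ s =
      gevreyWeight h t α * gevreyWeight h s β := by
    rw [multiLength_add, pow_add, gevreyWeight, gevreyWeight, mul_assoc, mul_mul_mul_comm]
  rw [hweight, div_le_iff₀ (mul_pos (gevreyWeight_pos hh α) (gevreyWeight_pos hh β)), norm_mul,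
    Complex.norm_real, Real.norm_eq_abs]

theorem IsGelfandShilov.exists_le (hf : IsGelfandShilov t s f) (hh : 0 < h) : ∃ C : ℝ, 0 ≤ C ∧
    ∀ (α β : Fin d →₀ ℕ) (x : Rd d),
      |monomialFn α x| * ‖multiD β f x‖ ≤ C * (gevreyWeight h t α * gevreyWeight h s β) := by
  obtain ⟨C, hC⟩ := isGelfandShilov_iff.1 hf h hh
  exact ⟨C, nonneg_of_mul_nonneg_left ((by positivity : (0 : ℝ) ≤ _).trans (hC 0 0 0))
    (mul_pos (gevreyWeight_pos hh 0) (gevreyWeight_pos hh 0)), hC⟩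

theorem IsGelfandShilov.of_norm_multiD_eq (hf : IsGelfandShilov t s f)
    (hg : ∀ (β : Fin d →₀ ℕ) (x : Rd d), ‖multiD β g x‖ = ‖multiD β f x‖) :
    IsGelfandShilov t s g := by
  simpa only [IsGelfandShilov, norm_div, norm_mul, hg] using hf

theorem IsGelfandShilov.conjugate (hf : IsGelfandShilov t s f) :
    IsGelfandShilov t s (conjugate f) :=
  hf.of_norm_multiD_eq fun β x => norm_multiD_conjugate_apply β f x

theorem IsGelfandShilov.neg (hf : IsGelfandShilov t s f) : IsGelfandShilov t s (-f) := by
  refine hf.of_norm_multiD_eq fun β x => ?_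
  rw [← neg_one_smul ℂ f, multiD_smul commute_coordD_schwartz, smul_apply, norm_smul, norm_neg,
    norm_one, one_mul]

theorem IsGelfandShilov.coordD (hs : 0 ≤ s) (hf : IsGelfandShilov t s f) (i : Fin d) :
    IsGelfandShilov t s (coordD i f) := by
  refine isGelfandShilov_iff.2 fun h hh => ?_
  obtain ⟨C, hC0, hC⟩ := hf.exists_le (h := h / 2 ^ s) (by positivity)
  refine ⟨C * h, fun α β x => ?_⟩
  have hle : h / 2 ^ s ≤ h := div_le_self hh.le (Real.one_le_rpow one_le_two hs)
  have hpos := gevreyWeight_pos (t := t) hh α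
  rw [multiD_coordD commute_coordD_schwartz]
  calc |monomialFn α x| * ‖multiD (β + Finsupp.single i 1) f x‖
      ≤ C * (gevreyWeight (h / 2 ^ s) t α *
          gevreyWeight (h / 2 ^ s) s (β + Finsupp.single i 1)) := hC _ _ _
    _ ≤ C * (gevreyWeight h t α * (h * gevreyWeight h s β)) := by
        have := (gevreyWeight_pos (t := s) (by positivity : 0 < h / 2 ^ s)
          (β + Finsupp.single i 1)).le
        gcongr
        · exact gevreyWeight_mono (by positivity) hle α
        · exact gevreyWeight_div_two_rpow_add_single_le hh hs β i
    _ = C * h * (gevreyWeight h t α * gevreyWeight h s β) := by ring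

theorem multiD_coordMul (β : Fin d →₀ ℕ) (i : Fin d) (f : 𝓢(Rd d, ℂ)) :
    multiD β (coordMul i f) = coordMul i (multiD β f) +
      (β i * -Complex.I : ℂ) • multiD (β - Finsupp.single i 1) f := by
  induction β using multiIndex_induction with
  | zero => simp [multiD_zero]
  | add_single β j ih =>
    rw [multiD_add_single commute_coordD_schwartz, ih, coordD_add, coordD_coordMul, coordD_smul,
      ← multiD_add_single commute_coordD_schwartz, ← multiD_add_single commute_coordD_schwartz,
      add_assoc]
    congr 1
    rcases eq_or_ne i j with rfl | hij
    · rw [if_pos rfl, add_tsub_cancel_right]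
      rcases eq_or_ne (β i) 0 with h0 | h0
      · simp [h0]
      · rw [tsub_add_cancel_of_le (Finsupp.single_le_iff.2 (Nat.one_le_iff_ne_zero.2 h0)),
          ← add_smul]
        simp only [Finsupp.add_apply, Finsupp.single_eq_same]
        congr 1
        push_cast
        ring
    · rw [if_neg hij, zero_smul, zero_add, Finsupp.add_apply, Finsupp.single_eq_of_ne hij,
        add_zero]
      congr 2
      ext k
      rcases eq_or_ne k i with rfl | hk
      · simp [hij]
      · simp [hk]

theorem norm_multiD_coordMul_le (β : Fin d →₀ ℕ) (i : Fin d) (f : 𝓢(Rd d, ℂ)) (x : Rd d) :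
    ‖multiD β (coordMul i f) x‖ ≤
      |x i| * ‖multiD β f x‖ + β i * ‖multiD (β - Finsupp.single i 1) f x‖ := by
  rw [multiD_coordMul, add_apply, smul_apply, coordMul_apply]
  refine (norm_add_le _ _).trans_eq ?_
  simp

theorem IsGelfandShilov.exists_mul_sub_single_le (hs : 0 ≤ s) (hf : IsGelfandShilov t s f)
    (i : Fin d) (hh : 0 < h) : ∃ C : ℝ, ∀ (α β : Fin d →₀ ℕ) (x : Rd d),
      |monomialFn α x| * (β i * ‖multiD (β - Finsupp.single i 1) f x‖) ≤
        C * (gevreyWeight h t α * gevreyWeight h s β) := by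
  obtain ⟨C, hC0, hC⟩ := hf.exists_le (h := h / 2) (by positivity)
  refine ⟨C * (2 / h), fun α β x => ?_⟩
  have hα := gevreyWeight_pos (t := t) hh α
  have hβ := gevreyWeight_pos (t := s) hh β
  rcases eq_or_ne (β i) 0 with h0 | h0
  · rw [h0, Nat.cast_zero, zero_mul, mul_zero]
    positivity
  obtain ⟨γ, rfl⟩ : ∃ γ, β = γ + Finsupp.single i 1 :=
    ⟨_, (tsub_add_cancel_of_le (Finsupp.single_le_iff.2 (Nat.one_le_iff_ne_zero.2 h0))).symm⟩
  have hγ := gevreyWeight_pos (t := s) (by positivity : 0 < h / 2) γ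
  rw [add_tsub_cancel_right, Finsupp.add_apply, Finsupp.single_eq_same, Nat.cast_succ]
  calc |monomialFn α x| * ((γ i + 1) * ‖multiD γ f x‖)
      = (γ i + 1) * (|monomialFn α x| * ‖multiD γ f x‖) := mul_left_comm _ _ _
    _ ≤ (γ i + 1) * (C * (gevreyWeight (h / 2) t α * gevreyWeight (h / 2) s γ)) := by
        exact mul_le_mul_of_nonneg_left (hC α γ x) (by positivity)
    _ ≤ (γ i + 1) * (C * (gevreyWeight h t α * gevreyWeight (h / 2) s γ)) := by
        gcongr; exact gevreyWeight_mono (by positivity) (by linarith) α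
    _ = C * gevreyWeight h t α * ((γ i + 1) * gevreyWeight (h / 2) s γ) := by ring
    _ ≤ C * gevreyWeight h t α * (2 / h * gevreyWeight h s (γ + Finsupp.single i 1)) := by
        exact mul_le_mul_of_nonneg_left (succ_apply_mul_gevreyWeight_div_two_le hh hs γ i)
          (by positivity)
    _ = C * (2 / h) * (gevreyWeight h t α * gevreyWeight h s (γ + Finsupp.single i 1)) := by ring

theorem IsGelfandShilov.exists_mul_coord_le (ht : 0 ≤ t) (hf : IsGelfandShilov t s f)
    (i : Fin d) (hh : 0 < h) : ∃ C : ℝ, ∀ (α β : Fin d →₀ ℕ) (x : Rd d),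
      |monomialFn α x| * (|x i| * ‖multiD β f x‖) ≤
        C * (gevreyWeight h t α * gevreyWeight h s β) := by
  obtain ⟨C, hC0, hC⟩ := hf.exists_le (h := h / 2 ^ t) (by positivity)
  refine ⟨C * h, fun α β x => ?_⟩
  have hle : h / 2 ^ t ≤ h := div_le_self hh.le (Real.one_le_rpow one_le_two ht)
  have hα := gevreyWeight_pos (t := t) hh α
  have hβ := gevreyWeight_pos (t := s) (by positivity : 0 < h / 2 ^ t) β
  calc |monomialFn α x| * (|x i| * ‖multiD β f x‖)
      = |monomialFn (α + Finsupp.single i 1) x| * ‖multiD β f x‖ := by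
        rw [monomialFn_add_single, abs_mul, mul_assoc]
    _ ≤ C * (gevreyWeight (h / 2 ^ t) t (α + Finsupp.single i 1) *
          gevreyWeight (h / 2 ^ t) s β) := hC _ _ _
    _ ≤ C * (h * gevreyWeight h t α * gevreyWeight h s β) := by
        gcongr
        · exact gevreyWeight_div_two_rpow_add_single_le hh ht α i
        · exact gevreyWeight_mono (by positivity) hle β
    _ = C * h * (gevreyWeight h t α * gevreyWeight h s β) := by ring

theorem IsGelfandShilov.coordMul (ht : 0 ≤ t) (hs : 0 ≤ s) (hf : IsGelfandShilov t s f)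
    (i : Fin d) : IsGelfandShilov t s (coordMul i f) := by
  refine isGelfandShilov_iff.2 fun h hh => ?_
  obtain ⟨C₁, hC₁⟩ := hf.exists_mul_coord_le ht i hh
  obtain ⟨C₂, hC₂⟩ := hf.exists_mul_sub_single_le hs i hh
  refine ⟨C₁ + C₂, fun α β x => ?_⟩
  rw [add_mul]
  refine (mul_le_mul_of_nonneg_left (norm_multiD_coordMul_le β i f x) (abs_nonneg _)).trans ?_
  rw [mul_add]
  exact add_le_add (hC₁ α β x) (hC₂ α β x)

theorem IsGelfandShilov.isSuperexponentiallyDecreasing (ht : 0 < t)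
    (hf : IsGelfandShilov t s f) : IsSuperexponentiallyDecreasing t f := by
  refine isSuperexponentiallyDecreasing_of_forall_pow_mul_le ht fun h hh j => ?_
  obtain ⟨C, -, hC⟩ := hf.exists_le hh
  refine ⟨C * gevreyWeight h s (0 : Fin d →₀ ℕ), fun k x => ?_⟩
  have hk := hC (Finsupp.single j k) 0 x
  rwa [monomialFn_single, abs_pow, multiD_zero, mul_comm (gevreyWeight _ _ _), ← mul_assoc] at hk

theorem norm_polyFn_le (q : MvPolynomial (Fin d) ℂ) (y : Rd d) :
    ‖polyFn q y‖ ≤ ∑ α ∈ q.support, ‖q.coeff α‖ * |monomialFn α y| := by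
  rw [polyFn, MvPolynomial.eval_eq']
  refine (norm_sum_le _ _).trans (Finset.sum_le_sum fun α _ => ?_)
  rw [norm_mul, monomialFn, Finset.abs_prod, norm_prod]
  simp only [norm_pow, Complex.norm_real, Real.norm_eq_abs, abs_pow, le_refl]

theorem IsGelfandShilov.exists_norm_polyFn_mul_le (hf : IsGelfandShilov t s f)
    (q : MvPolynomial (Fin d) ℂ) (hh : 0 < h) : ∃ C : ℝ, ∀ (β : Fin d →₀ ℕ) (y : Rd d),
      ‖polyFn q y‖ * ‖multiD β f y‖ ≤ C * gevreyWeight h s β := by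
  obtain ⟨C, -, hC⟩ := hf.exists_le hh
  refine ⟨∑ α ∈ q.support, ‖q.coeff α‖ * (C * gevreyWeight h t α), fun β y => ?_⟩
  calc ‖polyFn q y‖ * ‖multiD β f y‖
      ≤ (∑ α ∈ q.support, ‖q.coeff α‖ * |monomialFn α y|) * ‖multiD β f y‖ := by
        gcongr; exact norm_polyFn_le q y
    _ = ∑ α ∈ q.support, ‖q.coeff α‖ * (|monomialFn α y| * ‖multiD β f y‖) := by
        simp only [Finset.sum_mul, mul_assoc]
    _ ≤ ∑ α ∈ q.support, ‖q.coeff α‖ * (C * (gevreyWeight h t α * gevreyWeight h s β)) :=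
        Finset.sum_le_sum fun α _ => mul_le_mul_of_nonneg_left (hC α β y) (norm_nonneg _)
    _ = (∑ α ∈ q.support, ‖q.coeff α‖ * (C * gevreyWeight h t α)) * gevreyWeight h s β := by
        simp only [Finset.sum_mul, mul_assoc]

theorem norm_polyFn_one_add_sum_sq_pow (n : ℕ) (y : Rd d) :
    ‖polyFn ((1 + ∑ i, MvPolynomial.X i ^ 2) ^ n) y‖ = (1 + ‖y‖ ^ 2) ^ n := by
  have hpoly : polyFn ((1 + ∑ i, MvPolynomial.X i ^ 2) ^ n) y =
      (((1 + ‖y‖ ^ 2) ^ n : ℝ) : ℂ) := by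
    simp [polyFn, EuclideanSpace.norm_sq_eq]
  rw [hpoly, Complex.norm_real, Real.norm_of_nonneg (by positivity)]

theorem integrable_inv_one_add_norm_sq_pow :
    Integrable fun y : Rd d => ((1 + ‖y‖ ^ 2) ^ (d + 1))⁻¹ := by
  have hint : Integrable fun y : Rd d => (1 + ‖y‖ ^ 2) ^ (-(2 * ((d : ℝ) + 1)) / 2) := by
    refine integrable_rpow_neg_one_add_norm_sq ?_
    rw [finrank_euclideanSpace_fin]
    linarith [(Nat.cast_nonneg d : (0 : ℝ) ≤ d)]
  refine hint.congr (.of_forall fun y => ?_)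
  have hexp : -(2 * ((d : ℝ) + 1)) / 2 = -((d + 1 : ℕ) : ℝ) := by push_cast; ring
  simp only [hexp, Real.rpow_neg (by positivity : 0 ≤ 1 + ‖y‖ ^ 2), Real.rpow_natCast]

theorem IsGelfandShilov.exists_integral_norm_multiD_le (hf : IsGelfandShilov t s f) (hh : 0 < h) :
    ∃ C : ℝ, ∀ β : Fin d →₀ ℕ, ∫ y, ‖multiD β f y‖ ≤ C * gevreyWeight h s β := by
  obtain ⟨C, hC⟩ :=
    hf.exists_norm_polyFn_mul_le ((1 + ∑ i, MvPolynomial.X i ^ 2) ^ (d + 1)) hh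
  refine ⟨C * ∫ y : Rd d, ((1 + ‖y‖ ^ 2) ^ (d + 1))⁻¹, fun β => ?_⟩
  calc ∫ y, ‖multiD β f y‖
      ≤ ∫ y : Rd d, C * gevreyWeight h s β * ((1 + ‖y‖ ^ 2) ^ (d + 1))⁻¹ := by
        refine integral_mono (SchwartzMap.integrable _).norm
          (integrable_inv_one_add_norm_sq_pow.const_mul _) fun y => ?_
        rw [← div_eq_mul_inv, le_div_iff₀' (by positivity), ← norm_polyFn_one_add_sum_sq_pow]
        exact hC β y
    _ = C * (∫ y : Rd d, ((1 + ‖y‖ ^ 2) ^ (d + 1))⁻¹) * gevreyWeight h s β := by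
        rw [integral_const_mul, mul_right_comm]

theorem angularFourier_multiD (β : Fin d →₀ ℕ) (ξ : Rd d) (f : 𝓢(Rd d, ℂ)) :
    angularFourier ξ (multiD β f) = monomialFn β ξ * angularFourier ξ f := by
  induction β using multiIndex_induction with
  | zero => simp [multiD_zero, monomialFn]
  | add_single β i ih =>
    rw [multiD_add_single commute_coordD_schwartz, angularFourier_coordD, ih,
      monomialFn_add_single, Complex.ofReal_mul]
    ring

theorem IsGelfandShilov.isSuperexponentiallyDecreasing_angularFourier (hs : 0 < s)
    (hf : IsGelfandShilov t s f) :
    IsSuperexponentiallyDecreasing s fun ξ => angularFourier ξ f := by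
  refine isSuperexponentiallyDecreasing_of_forall_pow_mul_le hs fun h hh j => ?_
  obtain ⟨C, hC⟩ := hf.exists_integral_norm_multiD_le hh
  refine ⟨C, fun k ξ => ?_⟩
  calc |ξ j| ^ k * ‖angularFourier ξ f‖
      = ‖angularFourier ξ (multiD (Finsupp.single j k) f)‖ := by
        rw [angularFourier_multiD, monomialFn_single, norm_mul, Complex.norm_real,
          Real.norm_eq_abs, abs_pow]
    _ ≤ ∫ y, ‖multiD (Finsupp.single j k) f y‖ := norm_angularFourier_le ξ _
    _ ≤ C * gevreyWeight h s (Finsupp.single j k) := hC _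

end GelfandShilov

section Dirac

variable {d : ℕ} {t s : ℝ} {p : MvPolynomial (Fin d) ℂ} {φ f : 𝓢(Rd d, ℂ)}

theorem coefficientMap_diracMap_one_apply (f : 𝓢(Rd d, ℂ)) (x : Rd d) :
    coefficientMap diracMap translation f 1 x = f (-x) := by
  rw [coefficientMap_apply, diracMap_one_apply, translation_apply, zero_sub]

theorem coefficientMap_diracMap_mul_X (q : MvPolynomial (Fin d) ℂ) (i : Fin d) (f : 𝓢(Rd d, ℂ)) :
    coefficientMap diracMap translation f (q * MvPolynomial.X i) =
      coefficientMap diracMap translation (-coordD i f) q :=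
  coefficientMap_mul_X (S := fun i f => -coordD i f) (polyD_mul_X_apply _) (fun i x f => by
    rw [coordD_translation]
    exact (map_neg (SchwartzMap.compSubConstCLM ℂ x) _).symm) q i f

theorem exists_coefficientMap_diracMap_one_ne_zero (hf : f ≠ 0) :
    ∃ x, coefficientMap diracMap translation f 1 x ≠ 0 := by
  obtain ⟨x, hx⟩ := DFunLike.ne_iff.1 hf
  exact ⟨-x, by rwa [coefficientMap_diracMap_one_apply, neg_neg]⟩

theorem isRapidlyDecreasing_coefficientMap_diracMap (q : MvPolynomial (Fin d) ℂ)
    (f : 𝓢(Rd d, ℂ)) : IsRapidlyDecreasing (coefficientMap diracMap translation f q) := by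
  refine fun N => exists_weight_mul_norm_le_of_mul_X (P := fun _ => True) (fun x => by positivity)
    coefficientMap_diracMap_mul_X (fun _ _ _ => trivial) (fun f _ => ?_) q trivial
  obtain ⟨C, hC⟩ := isRapidlyDecreasing_schwartz f N
  refine ⟨C, fun x => ?_⟩
  rw [coefficientMap_diracMap_one_apply, ← norm_neg x]
  exact hC (-x)

theorem IsGelfandShilov.isSuperexponentiallyDecreasing_coefficientMap_diracMap (ht : 0 < t)
    (hs : 0 ≤ s) (hf : IsGelfandShilov t s f) (q : MvPolynomial (Fin d) ℂ) :
    IsSuperexponentiallyDecreasing t (coefficientMap diracMap translation f q) := by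
  refine fun r hr j => exists_weight_mul_norm_le_of_mul_X (P := IsGelfandShilov t s)
    (fun x => by positivity) coefficientMap_diracMap_mul_X (fun i f hf => (hf.coordD hs i).neg)
    (fun f hf => ?_) q hf
  obtain ⟨C, hC⟩ := hf.isSuperexponentiallyDecreasing ht r hr j
  refine ⟨C, fun x => ?_⟩
  rw [coefficientMap_diracMap_one_apply, ← abs_neg (x j), ← PiLp.neg_apply]
  exact hC (-x)

theorem gaborWF_diracCombination (hp : p ≠ 0) (hφ : φ ≠ 0) :
    gaborWF φ (diracCombination p) = {z | z.1 = 0 ∧ z.2 ≠ 0} :=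
  (gaborWF_eq_conicSingularSet φ _).trans <| conicSingularSet_eq_of_covariant
    (Complex.ofReal_ne_zero.2 (by positivity)) hp (norm_stft_diracCombination p φ)
    (exists_coefficientMap_diracMap_one_ne_zero (conjugate_ne_zero hφ))
    fun q => isRapidlyDecreasing_coefficientMap_diracMap q _

theorem gelfandShilovWF_diracCombination (hp : p ≠ 0) (hφ : φ ≠ 0) (ht : 0 < t) (hs : 0 < s)
    (h : IsGelfandShilov t s φ) :
    gelfandShilovWF t s φ (diracCombination p) = {z | z.1 = 0 ∧ z.2 ≠ 0} :=
  (gelfandShilovWF_eq_anisotropicSingularSet t s φ _).trans <|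
    anisotropicSingularSet_eq_of_covariant ht hs
      (Complex.ofReal_ne_zero.2 (by positivity)) hp (norm_stft_diracCombination p φ)
      (exists_coefficientMap_diracMap_one_ne_zero (conjugate_ne_zero hφ))
      (h.conjugate.isSuperexponentiallyDecreasing_coefficientMap_diracMap ht hs.le)

end Dirac

section Polynomial

variable {d : ℕ} {t s : ℝ} {p : MvPolynomial (Fin d) ℂ} {φ f : 𝓢(Rd d, ℂ)}

theorem coefficientMap_polyMap_one_apply (f : 𝓢(Rd d, ℂ)) (ξ : Rd d) :
    coefficientMap polyMap (fun ξ => modulation (-ξ)) f 1 ξ = angularFourier ξ f := by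
  rw [coefficientMap_apply, polyMap_one_apply, angularFourier_eq_integral]

theorem coefficientMap_polyMap_mul_X (q : MvPolynomial (Fin d) ℂ) (i : Fin d) (f : 𝓢(Rd d, ℂ)) :
    coefficientMap polyMap (fun ξ => modulation (-ξ)) f (q * MvPolynomial.X i) =
      coefficientMap polyMap (fun ξ => modulation (-ξ)) (coordMul i f) q :=
  coefficientMap_mul_X polyMap_mul_X_apply (fun i ξ f => by
    ext y
    simp only [coordMul_apply, modulation_apply, mul_left_comm]) q i f

theorem isRapidlyDecreasing_coefficientMap_polyMap (q : MvPolynomial (Fin d) ℂ)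
    (f : 𝓢(Rd d, ℂ)) :
    IsRapidlyDecreasing (coefficientMap polyMap (fun ξ => modulation (-ξ)) f q) := by
  refine fun N => exists_weight_mul_norm_le_of_mul_X (P := fun _ => True) (fun ξ => by positivity)
    coefficientMap_polyMap_mul_X (fun _ _ _ => trivial) (fun f _ => ?_) q trivial
  simpa only [coefficientMap_polyMap_one_apply] using isRapidlyDecreasing_angularFourier f N

theorem IsGelfandShilov.isSuperexponentiallyDecreasing_coefficientMap_polyMap (ht : 0 ≤ t)
    (hs : 0 < s) (hf : IsGelfandShilov t s f) (q : MvPolynomial (Fin d) ℂ) :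
    IsSuperexponentiallyDecreasing s
      (coefficientMap polyMap (fun ξ => modulation (-ξ)) f q) := by
  refine fun r hr j => exists_weight_mul_norm_le_of_mul_X (P := IsGelfandShilov t s)
    (fun ξ => by positivity) coefficientMap_polyMap_mul_X (fun i f hf => hf.coordMul ht hs.le i)
    (fun f hf => ?_) q hf
  simpa only [coefficientMap_polyMap_one_apply] using
    hf.isSuperexponentiallyDecreasing_angularFourier hs r hr j

theorem exists_coefficientMap_polyMap_one_ne_zero (hf : f ≠ 0) :
    ∃ ξ, coefficientMap polyMap (fun ξ => modulation (-ξ)) f 1 ξ ≠ 0 := by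
  simpa only [coefficientMap_polyMap_one_apply] using exists_angularFourier_ne_zero hf

theorem preimage_swap_setOf_fst_eq_zero :
    Prod.swap ⁻¹' {z : PhaseSpace d | z.1 = 0 ∧ z.2 ≠ 0} = {z | z.1 ≠ 0 ∧ z.2 = 0} :=
  Set.ext fun _ => and_comm

theorem gaborWF_polyDistribution (hp : p ≠ 0) (hφ : φ ≠ 0) :
    gaborWF φ (polyDistribution p) = {z | z.1 ≠ 0 ∧ z.2 = 0} := by
  rw [gaborWF_eq_conicSingularSet, conicSingularSet_flip, conicSingularSet_eq_of_covariant
    (Complex.ofReal_ne_zero.2 (by positivity)) hp (fun ξ x => norm_stft_polyDistribution p φ x ξ)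
    (exists_coefficientMap_polyMap_one_ne_zero (conjugate_ne_zero hφ))
    fun q => isRapidlyDecreasing_coefficientMap_polyMap q _, preimage_swap_setOf_fst_eq_zero]

theorem gelfandShilovWF_polyDistribution (hp : p ≠ 0) (hφ : φ ≠ 0) (ht : 0 < t) (hs : 0 < s)
    (h : IsGelfandShilov t s φ) :
    gelfandShilovWF t s φ (polyDistribution p) = {z | z.1 ≠ 0 ∧ z.2 = 0} := by
  rw [gelfandShilovWF_eq_anisotropicSingularSet, anisotropicSingularSet_flip,
    anisotropicSingularSet_eq_of_covariant hs ht (Complex.ofReal_ne_zero.2 (by positivity)) hp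
      (fun ξ x => norm_stft_polyDistribution p φ x ξ)
      (exists_coefficientMap_polyMap_one_ne_zero (conjugate_ne_zero hφ))
      (h.conjugate.isSuperexponentiallyDecreasing_coefficientMap_polyMap ht.le hs),
    preimage_swap_setOf_fst_eq_zero]

end Polynomial

end AnisotropicWF

theorem proposition7p2 {d : ℕ} (t s : ℝ) (ht : 0 < t) (hs : 0 < s) (hst : 1 < s + t)
    (p : MvPolynomial (Fin d) ℂ) (hp : p ≠ 0)
    (φ : 𝓢(AnisotropicWF.Rd d, ℂ)) (hφ : φ ≠ 0)
    (ψ : 𝓢(AnisotropicWF.Rd d, ℂ)) (hψ : AnisotropicWF.IsGelfandShilov t s ψ) (hψ0 : ψ ≠ 0) :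
    (AnisotropicWF.gaborWF φ (AnisotropicWF.diracCombination p) = {z | z.1 = 0 ∧ z.2 ≠ 0} ∧
      AnisotropicWF.gelfandShilovWF t s ψ (AnisotropicWF.diracCombination p) =
        {z | z.1 = 0 ∧ z.2 ≠ 0}) ∧
    (AnisotropicWF.gaborWF φ (AnisotropicWF.polyDistribution p) = {z | z.1 ≠ 0 ∧ z.2 = 0} ∧
      AnisotropicWF.gelfandShilovWF t s ψ (AnisotropicWF.polyDistribution p) =
        {z | z.1 ≠ 0 ∧ z.2 = 0}) :=
  ⟨⟨AnisotropicWF.gaborWF_diracCombination hp hφ,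
      AnisotropicWF.gelfandShilovWF_diracCombination hp hψ0 ht hs hψ⟩,
    AnisotropicWF.gaborWF_polyDistribution hp hφ,
    AnisotropicWF.gelfandShilovWF_polyDistribution hp hψ0 ht hs hψ⟩
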